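/- Let $R>0$ and let $B_R=\{x\in\mathbb{R}^2:|x|<R\}$. For a real-valued function $u\in L^2(B_R)$ and integers $j\ge 1$, define for almost every $r\in(0,R)$, writing $u(r,\theta)$ for $u(r\cos\theta,r\sin\theta)$, $$u_0^c(r)=\frac1{2\pi}\int_0^{2\pi}u(r,\theta)\,d\theta,\qquad u_j^c(r)=\frac1\pi\int_0^{2\pi}u(r,\theta)\cos(j\theta)\,d\theta,\qquad u_j^s(r)=\frac1\pi\int_0^{2\pi}u(r,\theta)\sin(j\theta)\,d\theta,$$ and, for every positive integer $J$, let $$u^J(r\cos\theta,r\sin\theta)=u_0^c(r)+\sum_{j=1}^J\bigl[u_j^c(r)\cos(j\theta)+u_j^s(r)\sin(j\theta)\bigr]$$ be the truncated angular Fourier expansion of $u$ on $B_R$. Then there exists a constant $C(R)>0$, depending only on $R$, such that for every $u\in H^2(B_R)$ and every positive integer $J$ one has $u^J-u\in H^1(B_R)$, $$\|u^J-u\|_{L^2(B_R)}\le\frac{C(R)}{J\sqrt J}\,\|u\|_{H^2(B_R)}\qquad\text{and}\qquad\|u^J-u\|_{H^1(B_R)}\le\frac{C(R)}{\sqrt J}\,\|u\|_{H^2(B_R)}.$$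 Here $\|u\|_{H^1}^2=\|u\|_{L^2}^2+\sum_i\|\partial_iu\|_{L^2}^2$ and $\|u\|_{H^2}^2=\|u\|_{H^1}^2+\sum_{i,j}\|\partial_j\partial_iu\|_{L^2}^2$, with weak derivatives. -/

import Mathlib

open MeasureTheory
open scoped ContDiff

noncomputable section

namespace AngularFourier

/-- The Euclidean plane. -/
abbrev Plane : Type := EuclideanSpace ℝ (Fin 2)

/-- `g` is the weak partial derivative `∂ᵢ u` on `Ω`: both functions are locally integrable on `Ω`
and `∫_Ω u ∂ᵢφ = -∫_Ω g φ` for every test function `φ ∈ C_c^∞(Ω)`. -/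
def IsWeakPartial (Ω : Set Plane) (i : Fin 2) (u g : Plane → ℝ) : Prop :=
  LocallyIntegrableOn u Ω volume ∧ LocallyIntegrableOn g Ω volume ∧
    ∀ φ : Plane → ℝ, ContDiff ℝ ∞ φ → HasCompactSupport φ → tsupport φ ⊆ Ω →
      ∫ x in Ω, u x * fderiv ℝ φ x (EuclideanSpace.single i 1) = -∫ x in Ω, g x * φ x

open Classical in
/-- The weak partial derivative `∂ᵢ u` on `Ω` (unique up to a null set of `Ω` when it exists;
`0` by convention when it does not). -/
def weakPartial (Ω : Set Plane) (i : Fin 2) (u : Plane → ℝ) : Plane → ℝ :=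
  if h : ∃ g, IsWeakPartial Ω i u g then h.choose else 0

/-- `u ∈ L²(Ω)`. -/
def MemL2 (Ω : Set Plane) (u : Plane → ℝ) : Prop :=
  MemLp u 2 (volume.restrict Ω)

/-- `u ∈ H¹(Ω)`: `u ∈ L²(Ω)` and it has weak partial derivatives in `L²(Ω)`. -/
def MemH1 (Ω : Set Plane) (u : Plane → ℝ) : Prop :=
  MemL2 Ω u ∧ ∀ i, ∃ g, IsWeakPartial Ω i u g ∧ MemL2 Ω g

/-- `u ∈ H²(Ω)`: `u ∈ L²(Ω)` and it has weak partial derivatives in `H¹(Ω)`. -/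
def MemH2 (Ω : Set Plane) (u : Plane → ℝ) : Prop :=
  MemL2 Ω u ∧ ∀ i, ∃ g, IsWeakPartial Ω i u g ∧ MemH1 Ω g

/-- `‖u‖_{L²(Ω)}`. -/
def normL2 (Ω : Set Plane) (u : Plane → ℝ) : ℝ :=
  (eLpNorm u 2 (volume.restrict Ω)).toReal

/-- `‖u‖_{H¹(Ω)}`, with `‖u‖²_{H¹} = ‖u‖²_{L²} + ∑ᵢ ‖∂ᵢu‖²_{L²}`. -/
def normH1 (Ω : Set Plane) (u : Plane → ℝ) : ℝ :=
  √(normL2 Ω u ^ 2 + ∑ i, normL2 Ω (weakPartial Ω i u) ^ 2)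

/-- `‖u‖_{H²(Ω)}`, with
`‖u‖²_{H²} = ‖u‖²_{L²} + ∑ᵢ ‖∂ᵢu‖²_{L²} + ∑ᵢⱼ ‖∂ⱼ∂ᵢu‖²_{L²}`. -/
def normH2 (Ω : Set Plane) (u : Plane → ℝ) : ℝ :=
  √(normL2 Ω u ^ 2 + ∑ i, normL2 Ω (weakPartial Ω i u) ^ 2
    + ∑ i, ∑ j, normL2 Ω (weakPartial Ω j (weakPartial Ω i u)) ^ 2)

/-- The point with polar coordinates `(r, θ)`. -/
def polarPoint (r θ : ℝ) : Plane := !₂[r * Real.cos θ, r * Real.sin θ]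

/-- `u₀ᶜ(r) = (1/2π) ∫₀^{2π} u(r,θ) dθ`. -/
def coeffZero (u : Plane → ℝ) (r : ℝ) : ℝ :=
  1 / (2 * Real.pi) * ∫ θ in (0 : ℝ)..2 * Real.pi, u (polarPoint r θ)

/-- `uⱼᶜ(r) = (1/π) ∫₀^{2π} u(r,θ) cos(jθ) dθ`, for `j ≥ 1`. -/
def coeffCos (u : Plane → ℝ) (j : ℕ) (r : ℝ) : ℝ :=
  1 / Real.pi * ∫ θ in (0 : ℝ)..2 * Real.pi, u (polarPoint r θ) * Real.cos (j * θ)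

/-- `uⱼˢ(r) = (1/π) ∫₀^{2π} u(r,θ) sin(jθ) dθ`, for `j ≥ 1`. -/
def coeffSin (u : Plane → ℝ) (j : ℕ) (r : ℝ) : ℝ :=
  1 / Real.pi * ∫ θ in (0 : ℝ)..2 * Real.pi, u (polarPoint r θ) * Real.sin (j * θ)

/-- The truncated angular Fourier expansion in polar coordinates:
`u₀ᶜ(r) + ∑_{j=1}^J [uⱼᶜ(r) cos(jθ) + uⱼˢ(r) sin(jθ)]`. -/
def truncationPolar (u : Plane → ℝ) (J : ℕ) (r θ : ℝ) : ℝ :=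
  coeffZero u r + ∑ j ∈ Finset.Icc 1 J,
    (coeffCos u j r * Real.cos (j * θ) + coeffSin u j r * Real.sin (j * θ))

/-- A polar angle of `x`, in `(-π, π]`. -/
def angle (x : Plane) : ℝ := Complex.arg ⟨x 0, x 1⟩

/-- The truncation `u^J` as a function on the plane. -/
def truncation (u : Plane → ℝ) (J : ℕ) (x : Plane) : ℝ :=
  truncationPolar u J ‖x‖ (angle x)

/-- In polar coordinates, `u^J` is given by the defining formula, whatever angle is used. -/
theorem truncation_polarPoint (u : Plane → ℝ) (J : ℕ) {r : ℝ} (hr : 0 < r) (θ : ℝ) :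
    truncation u J (polarPoint r θ) = truncationPolar u J r θ := by
  have hn : ‖polarPoint r θ‖ = r := by
    have h : (r * Real.cos θ) ^ 2 + (r * Real.sin θ) ^ 2 = r ^ 2 := by
      rw [mul_pow, mul_pow, ← mul_add, Real.cos_sq_add_sin_sq, mul_one]
    simp [polarPoint, EuclideanSpace.norm_eq, Fin.sum_univ_two, h, Real.sqrt_sq hr.le]
  have ha : ((angle (polarPoint r θ) : ℝ) : Real.Angle) = (θ : Real.Angle) := by
    have h : (⟨(polarPoint r θ) 0, (polarPoint r θ) 1⟩ : ℂ)
        = r * (Real.cos (θ : Real.Angle).toReal + Real.sin (θ : Real.Angle).toReal * Complex.I) := by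
      rw [← Real.Angle.cos_coe, ← Real.Angle.sin_coe, Real.Angle.coe_toReal]
      apply Complex.ext <;> simp [polarPoint, -Complex.ofReal_cos, -Complex.ofReal_sin]
    rw [angle, h]
    push_cast
    rw [Complex.arg_mul_cos_add_sin_mul_I hr (Real.Angle.toReal_mem_Ioc _), Real.Angle.coe_toReal]
  have hj (j : ℕ) : ((j * angle (polarPoint r θ) : ℝ) : Real.Angle) = ((j * θ : ℝ) : Real.Angle) := by
    rw [← nsmul_eq_mul, ← nsmul_eq_mul, Real.Angle.coe_nsmul, Real.Angle.coe_nsmul, ha]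
  simp only [truncation, truncationPolar, hn]
  congr 1
  refine Finset.sum_congr rfl fun j _ => ?_
  rw [← Real.Angle.cos_coe, ← Real.Angle.sin_coe, hj, Real.Angle.cos_coe, Real.Angle.sin_coe]

end AngularFourier

end

noncomputable section

namespace AngularFourier

open Set Filter Topology

/-! Truncating the angular expansion amounts to averaging rotates: for almost every `x` in the disk,
`u^J(x) = ∫ u(rot α x) D_J(α) dα` over a period, with `D_J` the Dirichlet kernel
(`truncation_ae_eq_rotAvg`). An average of rotates against a kernel `K` acts on angular Fourier
coefficients as a multiplier (`rotAvg_expKernel_rotAvg`), and the angular derivative `∂_θ = x₀∂₁ -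
x₁∂₀` acts as `ik` (`rotAvg_expKernel_angularDeriv`). Parseval on almost every circle, integrated
over the disk, turns bounds on coefficients into `L²` bounds (`normL2_le_of_coeff_le`).

For the `L²` estimate, the multiplier of `D_J` is the indicator of `|k| ≤ J`, so the error
multiplier is at most `(|k|/J)²`, and the error is at most `J⁻² ‖∂_θ²u‖`. The coordinates are
bounded by `R` on the disk, so `‖∂_θ²u‖` is controlled by the `H²` norm
(`MemH2.exists_second_angularDeriv`).

For the `H¹` estimate, a rotation mixes the partial derivatives with weights `±sin α` and `cos α`.
Hence `∂ᵢu^J` is a sum of averages of `∂₀u` and `∂₁u` against `D_J cos` and `±D_J sin`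
(`isWeakPartial_rotAvg`). These multipliers combine the values of the indicator at `k ± 1`: for `|k|
< J` they are exactly `1` and `0`, and otherwise they differ from `1` and `0` by at most `1 ≤
|k|/J`. The error is therefore `O(J⁻¹)` times `‖∂_θ∂₀u‖ + ‖∂_θ∂₁u‖`. Both rates, `J⁻²` and `J⁻¹`,
are stronger than those claimed.

Polar coordinates and restrictions to individual circles are avoided: identities between
coefficients are tested against smooth `φ`, through the periodic function `rotPair`, which is
regular in `α` even when `w` is only in `L²`. -/

/-! ### Rotations of the plane and their generator. -/

/-- The counterclockwise rotation of the plane by the angle `α`. -/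
def rot (α : ℝ) : Plane ≃ₗᵢ[ℝ] Plane where
  toFun x := !₂[Real.cos α * x 0 - Real.sin α * x 1, Real.sin α * x 0 + Real.cos α * x 1]
  invFun x := !₂[Real.cos α * x 0 + Real.sin α * x 1, -Real.sin α * x 0 + Real.cos α * x 1]
  map_add' x y := by ext i; fin_cases i <;> simp <;> ring
  map_smul' c x := by ext i; fin_cases i <;> simp <;> ring
  left_inv x := by
    ext i
    fin_cases i <;> simp
    · linear_combination x 0 * Real.sin_sq_add_cos_sq α
    · linear_combination x 1 * Real.sin_sq_add_cos_sq α
  right_inv x := by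
    ext i
    fin_cases i <;> simp
    · linear_combination x 0 * Real.sin_sq_add_cos_sq α
    · linear_combination x 1 * Real.sin_sq_add_cos_sq α
  norm_map' x := by
    simp only [LinearEquiv.coe_mk, LinearMap.coe_mk, AddHom.coe_mk, EuclideanSpace.norm_eq]
    congr 1
    simp [Fin.sum_univ_two]
    linear_combination (x 0 ^ 2 + x 1 ^ 2) * Real.sin_sq_add_cos_sq α

theorem rot_apply (α : ℝ) (x : Plane) :
    rot α x = !₂[Real.cos α * x 0 - Real.sin α * x 1, Real.sin α * x 0 + Real.cos α * x 1] := rfl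

theorem rot_add (α β : ℝ) (x : Plane) : rot (α + β) x = rot α (rot β x) := by
  ext i
  fin_cases i <;> simp [rot_apply, Real.cos_add, Real.sin_add] <;> ring

theorem rot_zero (x : Plane) : rot 0 x = x := by
  ext i
  fin_cases i <;> simp [rot_apply]

theorem rot_neg_rot (α : ℝ) (x : Plane) : rot (-α) (rot α x) = x := by
  rw [← rot_add, neg_add_cancel, rot_zero]

theorem rot_add_two_pi (α : ℝ) (x : Plane) : rot (α + 2 * Real.pi) x = rot α x := by
  simp [rot_apply]

theorem rot_polarPoint (α r θ : ℝ) : rot α (polarPoint r θ) = polarPoint r (α + θ) := by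
  ext i
  fin_cases i <;> simp [rot_apply, polarPoint, Real.cos_add, Real.sin_add] <;> ring

theorem polarPoint_norm_angle (x : Plane) : polarPoint ‖x‖ (angle x) = x := by
  have hn : ‖x‖ = ‖(⟨x 0, x 1⟩ : ℂ)‖ := by
    rw [EuclideanSpace.norm_eq, Complex.norm_eq_sqrt_sq_add_sq]
    simp [Fin.sum_univ_two]
  ext i
  fin_cases i
  · simp [polarPoint, angle, hn, Complex.norm_mul_cos_arg]
  · simp [polarPoint, angle, hn, Complex.norm_mul_sin_arg]

/-- The vector field `(-x₁, x₀)` generating the rotations. -/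
def perp (x : Plane) : Plane := !₂[-x 1, x 0]

theorem continuous_perp : Continuous perp := by
  unfold perp
  fun_prop

theorem rot_perp (α : ℝ) (x : Plane) : rot α (perp x) = perp (rot α x) := by
  ext i
  fin_cases i <;> simp [rot_apply, perp] <;> ring

theorem rot_eq_cos_add_sin (α : ℝ) (x : Plane) :
    rot α x = Real.cos α • x + Real.sin α • perp x := by
  ext i
  fin_cases i <;> simp [rot_apply, perp] <;> ring

theorem continuous_rot_comp {X : Type*} [TopologicalSpace X] {f : X → ℝ} {g : X → Plane}
    (hf : Continuous f) (hg : Continuous g) : Continuous fun x => rot (f x) (g x) := by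
  simp only [rot_eq_cos_add_sin]
  exact ((Real.continuous_cos.comp hf).smul hg).add
    ((Real.continuous_sin.comp hf).smul (continuous_perp.comp hg))

theorem continuous_rot : Continuous fun p : ℝ × Plane => rot p.1 p.2 :=
  continuous_rot_comp continuous_fst continuous_snd

theorem hasDerivAt_rot (α : ℝ) (x : Plane) :
    HasDerivAt (fun α => rot α x) (perp (rot α x)) α := by
  have h : perp (rot α x) = -Real.sin α • x + Real.cos α • perp x := by
    ext i
    fin_cases i <;> simp [rot_apply, perp] <;> ring
  simp only [rot_eq_cos_add_sin] at h ⊢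
  rw [h]
  exact ((Real.hasDerivAt_cos α).smul_const x).add ((Real.hasDerivAt_sin α).smul_const (perp x))

theorem rot_single_zero (α : ℝ) : rot α (EuclideanSpace.single 0 1) =
    Real.cos α • EuclideanSpace.single 0 1 + Real.sin α • EuclideanSpace.single 1 1 := by
  ext i
  fin_cases i <;> simp [rot_apply]

theorem rot_single_one (α : ℝ) : rot α (EuclideanSpace.single 1 1) =
    -Real.sin α • EuclideanSpace.single 0 1 + Real.cos α • EuclideanSpace.single 1 1 := by
  ext i
  fin_cases i <;> simp [rot_apply]

theorem perp_eq (x : Plane) :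
    perp x = x 0 • EuclideanSpace.single 1 1 - x 1 • EuclideanSpace.single 0 1 := by
  ext i
  fin_cases i <;> simp [perp]

/-! ### Rotation invariance and Fubini on circles. -/

/-- Lebesgue measure on the disk of radius `R`. -/
abbrev diskMeasure (R : ℝ) : Measure Plane := volume.restrict (Metric.ball 0 R)

/-- Lebesgue measure on a period `(0, 2π]` of angles. -/
abbrev angleMeasure : Measure ℝ := volume.restrict (Ioc 0 (2 * Real.pi))

instance isFiniteMeasure_diskMeasure (R : ℝ) : IsFiniteMeasure (diskMeasure R) :=
  ⟨by rw [Measure.restrict_apply_univ]; exact measure_ball_lt_top⟩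

theorem rot_preimage_ball (α R : ℝ) : rot α ⁻¹' Metric.ball 0 R = Metric.ball 0 R := by
  ext x
  simp

theorem measurePreserving_rot (α R : ℝ) :
    MeasurePreserving (rot α) (diskMeasure R) (diskMeasure R) := by
  have := (rot α).measurePreserving.restrict_preimage
    (measurableSet_ball (x := (0 : Plane)) (ε := R))
  rwa [rot_preimage_ball] at this

/-- The map `(α, x) ↦ (α, rot α x)` preserves the product measure. -/
theorem measurePreserving_prod_rot (R : ℝ) :
    MeasurePreserving (fun p : ℝ × Plane => (p.1, rot p.1 p.2))
      (angleMeasure.prod (diskMeasure R)) (angleMeasure.prod (diskMeasure R)) :=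
  (MeasurePreserving.id angleMeasure).skew_product (g := fun α x => rot α x)
    continuous_rot.measurable (ae_of_all _ fun α => (measurePreserving_rot α R).map_eq)

theorem integral_comp_rot {E : Type*} [NormedAddCommGroup E] [NormedSpace ℝ E] (α R : ℝ)
    (f : Plane → E) : ∫ x, f (rot α x) ∂diskMeasure R = ∫ x, f x ∂diskMeasure R :=
  (measurePreserving_rot α R).integral_comp
    (rot α).toHomeomorph.measurableEmbedding f

theorem memLp_comp_rot {R : ℝ} {w : Plane → ℝ} (hw : MemLp w 2 (diskMeasure R)) :
    MemLp (fun p : ℝ × Plane => w (rot p.1 p.2)) 2 (angleMeasure.prod (diskMeasure R)) :=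
  (hw.comp_snd angleMeasure).comp_measurePreserving (measurePreserving_prod_rot R)

/-- Fubini for the product of angles and disk replaces disintegration in polar coordinates: the
point `x` labels the circle through it, parametrised from `x`. -/
theorem ae_memLp_slice {R : ℝ} {w : Plane → ℝ} (hw : MemLp w 2 (diskMeasure R)) :
    ∀ᵐ x ∂diskMeasure R, MemLp (fun α => w (rot α x)) 2 angleMeasure := by
  have h := memLp_comp_rot hw
  filter_upwards [h.integrable_sq.prod_left_ae, h.aestronglyMeasurable.prodMk_right] with x hx hx'
  exact (memLp_two_iff_integrable_sq hx').2 hx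

/-- The square integral over the disk is the mean of the square integrals over circles. -/
theorem integral_integral_sq_slice {R : ℝ} {w : Plane → ℝ} (hw : MemLp w 2 (diskMeasure R)) :
    ∫ x, (∫ α, w (rot α x) ^ 2 ∂angleMeasure) ∂diskMeasure R
      = 2 * Real.pi * ∫ x, w x ^ 2 ∂diskMeasure R := by
  rw [integral_integral_swap (f := fun x α => w (rot α x) ^ 2)
    (memLp_comp_rot hw).integrable_sq.swap]
  have (α : ℝ) : ∫ x, w (rot α x) ^ 2 ∂diskMeasure R = ∫ x, w x ^ 2 ∂diskMeasure R :=
    integral_comp_rot α R (fun x => w x ^ 2)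
  simp [this, Real.pi_pos.le]

/-! ### Test functions under rotation, and uniform bounds. -/

/-- A smooth function with compact support in `Ω`. -/
structure IsTestFunction (Ω : Set Plane) (φ : Plane → ℝ) : Prop where
  contDiff : ContDiff ℝ ∞ φ
  hasCompactSupport : HasCompactSupport φ
  tsupport_subset : tsupport φ ⊆ Ω

theorem IsTestFunction.continuous {Ω : Set Plane} {φ : Plane → ℝ} (h : IsTestFunction Ω φ) :
    Continuous φ := h.contDiff.continuous

theorem IsTestFunction.continuous_fderiv {Ω : Set Plane} {φ : Plane → ℝ}
    (h : IsTestFunction Ω φ) : Continuous (fderiv ℝ φ) :=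
  h.contDiff.continuous_fderiv (by simp)

theorem IsTestFunction.comp_rot {R : ℝ} {φ : Plane → ℝ}
    (h : IsTestFunction (Metric.ball 0 R) φ) (α : ℝ) :
    IsTestFunction (Metric.ball 0 R) (fun x => φ (rot α x)) where
  contDiff := h.contDiff.comp (rot α).contDiff
  hasCompactSupport := h.hasCompactSupport.comp_homeomorph (rot α).toHomeomorph
  tsupport_subset := by
    have : tsupport (fun x => φ (rot α x)) = rot α ⁻¹' tsupport φ :=
      tsupport_comp_eq_preimage φ (rot α).toHomeomorph
    rw [this, ← rot_preimage_ball α R]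
    exact preimage_mono h.tsupport_subset

theorem IsTestFunction.mul {Ω : Set Plane} {φ : Plane → ℝ} (h : IsTestFunction Ω φ)
    {f : Plane → ℝ} (hf : ContDiff ℝ ∞ f) : IsTestFunction Ω (fun x => f x * φ x) where
  contDiff := hf.mul h.contDiff
  hasCompactSupport := h.hasCompactSupport.mul_left
  tsupport_subset := (closure_mono (Function.support_mul_subset_right f φ)).trans
    h.tsupport_subset

theorem fderiv_comp_rot {φ : Plane → ℝ} (hφ : Differentiable ℝ φ) (α : ℝ) (x v : Plane) :
    fderiv ℝ (fun x => φ (rot α x)) x v = fderiv ℝ φ (rot α x) (rot α v) := by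
  have h : HasFDerivAt (fun x => φ (rot α x))
      ((fderiv ℝ φ (rot α x)).comp ((rot α).toContinuousLinearEquiv : Plane →L[ℝ] Plane)) x :=
    (hφ (rot α x)).hasFDerivAt.comp x (rot α).toContinuousLinearEquiv.hasFDerivAt
  rw [h.fderiv]
  rfl

variable {E : Type*} [NormedAddCommGroup E] [NormedSpace ℝ E]

/-- A continuous function is bounded on the disk, uniformly over all rotations. -/
theorem exists_bound_comp_rot {φ : Plane → ℝ} (hφ : Continuous φ) (R : ℝ) :
    ∃ C, ∀ᵐ x ∂diskMeasure R, ∀ α, ‖φ (rot α x)‖ ≤ C := by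
  obtain ⟨C, hC⟩ := (isCompact_closedBall (0 : Plane) R).exists_bound_of_continuousOn
    hφ.continuousOn
  refine ⟨C, ?_⟩
  filter_upwards [ae_restrict_mem measurableSet_ball] with x hx α
  refine hC _ ?_
  simpa using (mem_ball_zero_iff.1 hx).le

theorem exists_bound_angle {F : Type*} [NormedAddCommGroup F] {K : ℝ → F} (hK : Continuous K) :
    ∃ C, 0 ≤ C ∧ ∀ᵐ α ∂angleMeasure, ‖K α‖ ≤ C := by
  obtain ⟨C, hC⟩ := (isCompact_Icc (a := (0 : ℝ)) (b := 2 * Real.pi)).exists_bound_of_continuousOn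
    hK.continuousOn
  refine ⟨|C|, abs_nonneg _, ?_⟩
  filter_upwards [ae_restrict_mem measurableSet_Ioc] with α hα
  exact (hC α (Ioc_subset_Icc_self hα)).trans (le_abs_self C)

theorem integrable_mul_continuous {R : ℝ} {w φ : Plane → ℝ} (hw : MemLp w 2 (diskMeasure R))
    (hφ : Continuous φ) : Integrable (fun x => w x * φ x) (diskMeasure R) := by
  obtain ⟨C, hC⟩ := exists_bound_comp_rot hφ R
  refine (hw.integrable one_le_two).mul_bdd (c := C) hφ.aestronglyMeasurable ?_
  filter_upwards [hC] with x hx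
  simpa [rot_zero] using hx 0

/-! ### Averages of rotates and their pairings with test functions. -/

/-- The average of the rotates of `w` against the kernel `K`. -/
def rotAvg (K : ℝ → E) (w : Plane → ℝ) (x : Plane) : E :=
  ∫ α, w (rot α x) • K α ∂angleMeasure

/-- The pairing of the rotates of `w` with `φ` on the disk. -/
def rotPair (R : ℝ) (w φ : Plane → ℝ) (α : ℝ) : ℝ :=
  ∫ x, w x * φ (rot (-α) x) ∂diskMeasure R

theorem memLp_kernel {K : ℝ → E} (hK : Continuous K) {R : ℝ} {w : Plane → ℝ}
    (hw : MemLp w 2 (diskMeasure R)) :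
    MemLp (fun p : ℝ × Plane => w (rot p.1 p.2) • K p.1) 2
      (angleMeasure.prod (diskMeasure R)) := by
  obtain ⟨C, hC0, hC⟩ := exists_bound_angle hK
  have h := memLp_comp_rot hw
  refine h.of_le_mul (c := C) (h.aestronglyMeasurable.smul
    (hK.comp continuous_fst).aestronglyMeasurable) ?_
  filter_upwards [Measure.quasiMeasurePreserving_fst.ae hC] with p hp
  rw [norm_smul, mul_comm]
  gcongr

theorem integrable_rotAvg {K : ℝ → E} (hK : Continuous K) {R : ℝ} {w : Plane → ℝ}
    (hw : MemLp w 2 (diskMeasure R)) : Integrable (rotAvg K w) (diskMeasure R) :=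
  ((memLp_kernel hK hw).integrable one_le_two).integral_prod_right

/-- Nonnegativity of the variance: expand `∫ (f - c)² ≥ 0` with `c` the mean of `f`. The zero
measure, which has no mean, is treated apart. -/
theorem sq_integral_le {X : Type*} [MeasurableSpace X] {m : Measure X} [IsFiniteMeasure m]
    {f : X → ℝ} (hf : MemLp f 2 m) : (∫ x, f x ∂m) ^ 2 ≤ m.real univ * ∫ x, f x ^ 2 ∂m := by
  rcases (measureReal_nonneg (μ := m) (s := univ)).eq_or_lt with h0 | h0
  · have : m = 0 := by
      rw [← Measure.measure_univ_eq_zero]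
      exact (measureReal_eq_zero_iff).1 h0.symm
    simp [this]
  · set a := ∫ x, f x ∂m
    set c := a / m.real univ
    have hi := hf.integrable one_le_two
    have h : 0 ≤ ∫ x, (f x ^ 2 - (2 * c * f x - c ^ 2)) ∂m :=
      integral_nonneg fun x => by
        have := sq_nonneg (f x - c)
        simp only [Pi.zero_apply]
        linarith
    have hi' : Integrable (fun x => 2 * c * f x - c ^ 2) m :=
      (hi.const_mul _).sub (integrable_const _)
    rw [integral_sub hf.integrable_sq hi', integral_sub (hi.const_mul _) (integrable_const _),
      integral_const_mul, integral_const] at h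
    have hc : c * m.real univ = a := div_mul_cancel₀ _ h0.ne'
    simp only [smul_eq_mul] at h
    change 0 ≤ _ - (2 * c * a - m.real univ * c ^ 2) at h
    have h2 := mul_nonneg h0.le h
    nlinarith

theorem memLp_rotAvg {K : ℝ → ℝ} (hK : Continuous K) {R : ℝ} {w : Plane → ℝ}
    (hw : MemLp w 2 (diskMeasure R)) : MemLp (rotAvg K w) 2 (diskMeasure R) := by
  have h := memLp_kernel hK hw
  have hm := (integrable_rotAvg hK hw).aestronglyMeasurable
  refine (memLp_two_iff_integrable_sq hm).2 ?_
  refine (h.integrable_sq.integral_prod_right.const_mul (angleMeasure.real univ)).mono'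
    (hm.pow 2) ?_
  filter_upwards [h.integrable_sq.prod_left_ae, h.aestronglyMeasurable.prodMk_right] with x hx hx'
  rw [Real.norm_of_nonneg (sq_nonneg _)]
  exact sq_integral_le ((memLp_two_iff_integrable_sq hx').2 hx)

/-- Pairing an average of rotates with a continuous function. -/
theorem integral_smul_rotAvg [CompleteSpace E] {K : ℝ → E} (hK : Continuous K) {R : ℝ}
    {w φ : Plane → ℝ} (hw : MemLp w 2 (diskMeasure R)) (hφ : Continuous φ) :
    ∫ x, φ x • rotAvg K w x ∂diskMeasure R = ∫ α, rotPair R w φ α • K α ∂angleMeasure := by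
  obtain ⟨C, hC⟩ := exists_bound_comp_rot hφ R
  have hint : Integrable (fun p : ℝ × Plane => φ p.2 • (w (rot p.1 p.2) • K p.1))
      (angleMeasure.prod (diskMeasure R)) := by
    refine ((memLp_kernel hK hw).integrable one_le_two).bdd_smul C
      (hφ.comp continuous_snd).aestronglyMeasurable ?_
    filter_upwards [Measure.quasiMeasurePreserving_snd.ae hC] with p hp
    simpa [rot_zero] using hp 0
  have h1 (x : Plane) : φ x • rotAvg K w x
      = ∫ α, φ x • (w (rot α x) • K α) ∂angleMeasure := (integral_smul _ _).symm
  simp_rw [h1]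
  rw [integral_integral_swap (f := fun x α => φ x • (w (rot α x) • K α)) hint.swap]
  congr 1
  ext α
  simp_rw [smul_smul]
  rw [integral_smul_const]
  congr 1
  -- Invariance of the disk moves the rotation from `w` to the inverse rotation on `φ`.
  rw [rotPair, ← integral_comp_rot α R (fun x => w x * φ (rot (-α) x))]
  simp_rw [rot_neg_rot, mul_comm]

theorem rotPair_add_two_pi (R : ℝ) (w φ : Plane → ℝ) (α : ℝ) :
    rotPair R w φ (α + 2 * Real.pi) = rotPair R w φ α := by
  have (x : Plane) : rot (-(α + 2 * Real.pi)) x = rot (-α) x := by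
    rw [← rot_add_two_pi]
    congr 1
    congr 1
    ring
  simp only [rotPair, this]

theorem rotPair_comp_rot (R : ℝ) (w φ : Plane → ℝ) (α β : ℝ) :
    rotPair R w (fun x => φ (rot (-β) x)) α = rotPair R w φ (α + β) := by
  simp_rw [rotPair, ← rot_add, neg_add_rev]

/-- All the regularity in `α` comes from `φ`; the function `w` only supplies an integrable
dominating function. -/
theorem continuous_rotPair {R : ℝ} {w φ : Plane → ℝ} (hw : MemLp w 2 (diskMeasure R))
    (hφ : Continuous φ) : Continuous (rotPair R w φ) := by
  obtain ⟨C, hC⟩ := exists_bound_comp_rot hφ R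
  refine continuous_of_dominated (bound := fun x => ‖w x‖ * C) (fun α => ?_) (fun α => ?_)
    ((hw.integrable one_le_two).norm.mul_const C) (ae_of_all _ fun x => ?_)
  · exact hw.aestronglyMeasurable.mul
      (hφ.comp (rot (-α)).continuous).aestronglyMeasurable
  · filter_upwards [hC] with x hx
    rw [norm_mul]
    gcongr
    exact hx _
  · exact continuous_const.mul (hφ.comp (continuous_rot_comp continuous_neg continuous_const))

/-- A function orthogonal to all test functions on the disk vanishes there. -/
theorem ae_eq_zero_of_integral_test [CompleteSpace E] {R : ℝ} {f : Plane → E}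
    (hf : LocallyIntegrableOn f (Metric.ball 0 R))
    (h : ∀ φ, IsTestFunction (Metric.ball 0 R) φ → ∫ x, φ x • f x ∂diskMeasure R = 0) :
    f =ᵐ[diskMeasure R] 0 := by
  have := Metric.isOpen_ball.ae_eq_zero_of_integral_contDiff_smul_eq_zero hf
    fun φ h1 h2 h3 => by
      rw [← h φ ⟨h1, h2, h3⟩]
      refine (setIntegral_eq_integral_of_forall_compl_eq_zero fun x hx => ?_).symm
      rw [image_eq_zero_of_notMem_tsupport fun hx' => hx (h3 hx'), zero_smul]
  exact (ae_restrict_iff' measurableSet_ball).2 this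

theorem locallyIntegrableOn_ball_of_memLp {R : ℝ} {w : Plane → ℝ}
    (hw : MemLp w 2 (diskMeasure R)) : LocallyIntegrableOn w (Metric.ball 0 R) :=
  IntegrableOn.locallyIntegrableOn (hw.integrable one_le_two)

/-! ### The angular derivative on angular Fourier coefficients. -/

/-- `g` is the weak derivative of `w` along the rotation field on `Ω`. -/
def IsAngularDeriv (Ω : Set Plane) (w g : Plane → ℝ) : Prop :=
  ∀ φ, IsTestFunction Ω φ →
    ∫ x in Ω, w x * fderiv ℝ φ x (perp x) = -∫ x in Ω, g x * φ x

/-- The exponential `e^{-ikα}`. -/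
def expKernel (k : ℤ) (α : ℝ) : ℂ := Complex.exp (-(k * α * Complex.I))

theorem continuous_expKernel (k : ℤ) : Continuous (expKernel k) := by
  unfold expKernel
  fun_prop

theorem expKernel_add (k : ℤ) (α β : ℝ) :
    expKernel k (α + β) = expKernel k α * expKernel k β := by
  rw [expKernel, expKernel, expKernel, ← Complex.exp_add]
  congr 1
  push_cast
  ring

theorem expKernel_two_pi (k : ℤ) : expKernel k (2 * Real.pi) = 1 := by
  rw [expKernel, Complex.exp_eq_one_iff]
  exact ⟨-k, by push_cast; ring⟩

theorem expKernel_zero (k : ℤ) : expKernel k 0 = 1 := by simp [expKernel]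

theorem hasDerivAt_expKernel (k : ℤ) (α : ℝ) :
    HasDerivAt (expKernel k) (-(k * Complex.I) * expKernel k α) α := by
  have h : HasDerivAt (fun α : ℝ => -((k : ℂ) * (α : ℂ) * Complex.I)) (-(k * Complex.I)) α := by
    have := (((hasDerivAt_id α).ofReal_comp.const_mul (k : ℂ)).mul_const Complex.I).neg
    simp only [Complex.ofReal_one, mul_one] at this
    exact this
  have := h.cexp
  rwa [mul_comm] at this

theorem integral_angleMeasure {E : Type*} [NormedAddCommGroup E] [NormedSpace ℝ E] (f : ℝ → E) :
    ∫ α, f α ∂angleMeasure = ∫ α in (0 : ℝ)..2 * Real.pi, f α :=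
  (intervalIntegral.integral_of_le (by positivity)).symm

theorem integral_angleMeasure_add {E : Type*} [NormedAddCommGroup E] [NormedSpace ℝ E]
    {f : ℝ → E} (hf : Function.Periodic f (2 * Real.pi)) (β : ℝ) :
    ∫ α, f (α + β) ∂angleMeasure = ∫ α, f α ∂angleMeasure := by
  rw [integral_angleMeasure, integral_angleMeasure, intervalIntegral.integral_comp_add_right,
    zero_add, add_comm (2 * Real.pi) β, hf.intervalIntegral_add_eq β 0, zero_add]

/-- Differentiating the pairing of rotates gives the pairing of the angular derivative. -/
theorem hasDerivAt_rotPair {R : ℝ} {w g φ : Plane → ℝ} (hw : MemLp w 2 (diskMeasure R))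
    (hwg : IsAngularDeriv (Metric.ball 0 R) w g) (hφ : IsTestFunction (Metric.ball 0 R) φ)
    (α : ℝ) : HasDerivAt (rotPair R w φ) (rotPair R g φ α) α := by
  have hd : Differentiable ℝ φ := hφ.contDiff.differentiable (by simp)
  set D : Plane → ℝ := fun y => -fderiv ℝ φ y (perp y) with hD
  have hDc : Continuous D := (hφ.continuous_fderiv.clm_apply continuous_perp).neg
  obtain ⟨C, hC⟩ := exists_bound_comp_rot hDc R
  -- The rotation field commutes with rotations, so the weak identity can be tested on the rotated
  -- `φ`.
  have hder : ∫ x, w x * D (rot (-α) x) ∂diskMeasure R = rotPair R g φ α := by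
    have h := hwg _ (hφ.comp_rot (-α))
    simp_rw [fderiv_comp_rot hd, rot_perp] at h
    simp only [hD, mul_neg, integral_neg, h, neg_neg]
    rfl
  rw [← hder]
  refine (hasDerivAt_integral_of_dominated_loc_of_deriv_le (s := univ)
    (F := fun α x => w x * φ (rot (-α) x)) (F' := fun α x => w x * D (rot (-α) x))
    (bound := fun x => ‖w x‖ * C) univ_mem
    (Eventually.of_forall fun α => hw.aestronglyMeasurable.mul
      (hφ.continuous.comp (rot (-α)).continuous).aestronglyMeasurable)
    (integrable_mul_continuous hw (hφ.continuous.comp (rot (-α)).continuous))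
    (hw.aestronglyMeasurable.mul (hDc.comp (rot (-α)).continuous).aestronglyMeasurable)
    ?_ ((hw.integrable one_le_two).norm.mul_const C) (ae_of_all _ fun x β _ => ?_)).2
  · filter_upwards [hC] with x hx β _
    rw [norm_mul]
    gcongr
    exact hx _
  · refine HasDerivAt.const_mul _ ?_
    have h1 : HasDerivAt (fun β => rot (-β) x) (-perp (rot (-β) x)) β := by
      have := (hasDerivAt_rot (-β) x).scomp β (hasDerivAt_neg β)
      rw [neg_one_smul] at this
      exact this
    have h2 := (hd (rot (-β) x)).hasFDerivAt.comp_hasDerivAt β h1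
    rw [map_neg] at h2
    exact h2

theorem integrable_continuous_smul {R : ℝ} {f : Plane → ℂ} {φ : Plane → ℝ}
    (hf : Integrable f (diskMeasure R)) (hφ : Continuous φ) :
    Integrable (fun x => φ x • f x) (diskMeasure R) := by
  obtain ⟨C, hC⟩ := exists_bound_comp_rot hφ R
  refine hf.bdd_smul C hφ.aestronglyMeasurable ?_
  filter_upwards [hC] with x hx
  simpa [rot_zero] using hx 0

/-- Angular Fourier coefficients are determined by the pairings with test functions. -/
theorem rotAvg_expKernel_ae_eq {R : ℝ} {w g : Plane → ℝ} (hw : MemLp w 2 (diskMeasure R))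
    (hg : MemLp g 2 (diskMeasure R)) (k : ℤ) (c : ℂ)
    (h : ∀ φ, IsTestFunction (Metric.ball 0 R) φ →
      ∫ α, rotPair R g φ α • expKernel k α ∂angleMeasure
        = c * ∫ α, rotPair R w φ α • expKernel k α ∂angleMeasure) :
    ∀ᵐ x ∂diskMeasure R, rotAvg (expKernel k) g x = c * rotAvg (expKernel k) w x := by
  have hK := continuous_expKernel k
  have hiw := integrable_rotAvg hK hw
  have hig := integrable_rotAvg hK hg
  have h0 : (fun x => rotAvg (expKernel k) g x - c * rotAvg (expKernel k) w x)
      =ᵐ[diskMeasure R] 0 := by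
    refine ae_eq_zero_of_integral_test
      (IntegrableOn.locallyIntegrableOn (hig.sub (hiw.const_mul _))) fun φ hφ => ?_
    simp_rw [smul_sub, ← mul_smul_comm]
    rw [integral_sub (integrable_continuous_smul hig hφ.continuous)
        ((integrable_continuous_smul hiw hφ.continuous).const_mul _),
      integral_const_mul, integral_smul_rotAvg hK hg hφ.continuous,
      integral_smul_rotAvg hK hw hφ.continuous, h φ hφ, sub_self]
  filter_upwards [h0] with x hx
  exact sub_eq_zero.1 hx

/-- The angular derivative acts on angular Fourier coefficients as multiplication by `ik`. -/
theorem rotAvg_expKernel_angularDeriv {R : ℝ} {w g : Plane → ℝ} (hw : MemLp w 2 (diskMeasure R))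
    (hg : MemLp g 2 (diskMeasure R)) (hwg : IsAngularDeriv (Metric.ball 0 R) w g) (k : ℤ) :
    ∀ᵐ x ∂diskMeasure R,
      rotAvg (expKernel k) g x = (k * Complex.I) * rotAvg (expKernel k) w x := by
  have hK := continuous_expKernel k
  refine rotAvg_expKernel_ae_eq hw hg k _ fun φ hφ => ?_
  rw [integral_angleMeasure, integral_angleMeasure]
  have hH (α : ℝ) := (hasDerivAt_rotPair hw hwg hφ α).ofReal_comp
  have hcg := Complex.continuous_ofReal.comp (continuous_rotPair hg hφ.continuous)
  -- Integration by parts over a full period: both factors are `2π`-periodic, so the boundary terms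
  -- cancel.
  have hIBP := intervalIntegral.integral_mul_deriv_eq_deriv_mul (a := 0) (b := 2 * Real.pi)
    (fun α _ => hH α) (fun α _ => hasDerivAt_expKernel k α)
    (hcg.intervalIntegrable _ _) ((hK.const_mul _).intervalIntegrable _ _)
  have hper := rotPair_add_two_pi R w φ 0
  rw [zero_add] at hper
  rw [expKernel_two_pi, expKernel_zero, hper, sub_self, zero_sub] at hIBP
  simp only [Complex.real_smul]
  rw [← neg_eq_iff_eq_neg] at hIBP
  rw [← hIBP, ← intervalIntegral.integral_neg, ← intervalIntegral.integral_const_mul]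
  congr 1
  ext α
  ring

/-! ### Averages of rotates as Fourier multipliers. -/

/-- The Fourier multiplier of the average of rotates against `K`. -/
def multiplier (K : ℝ → ℝ) (k : ℤ) : ℂ := ∫ α, (K α : ℂ) * expKernel (-k) α ∂angleMeasure

/-- This reduces the multiplier property to a correlation on the circle of angles, where it follows
by Fubini and a translation. -/
theorem rotPair_rotAvg {K : ℝ → ℝ} (hK : Continuous K) {R : ℝ} {w φ : Plane → ℝ}
    (hw : MemLp w 2 (diskMeasure R)) (hφ : Continuous φ) (β : ℝ) :
    rotPair R (rotAvg K w) φ β = ∫ α, rotPair R w φ (α + β) * K α ∂angleMeasure := by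
  have := integral_smul_rotAvg hK hw (hφ.comp (rot (-β)).continuous)
  simp only [smul_eq_mul, Function.comp_def, rotPair_comp_rot] at this
  rw [← this, rotPair]
  simp_rw [mul_comm]

/-- Averaging rotates acts on angular Fourier coefficients as a multiplier. -/
theorem rotAvg_expKernel_rotAvg {K : ℝ → ℝ} (hK : Continuous K) {R : ℝ} {w : Plane → ℝ}
    (hw : MemLp w 2 (diskMeasure R)) (k : ℤ) :
    ∀ᵐ x ∂diskMeasure R,
      rotAvg (expKernel k) (rotAvg K w) x = multiplier K k * rotAvg (expKernel k) w x := by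
  have he := continuous_expKernel k
  refine rotAvg_expKernel_ae_eq hw (memLp_rotAvg hK hw) k _ fun φ hφ => ?_
  have hH := continuous_rotPair hw hφ.continuous
  simp_rw [rotPair_rotAvg hK hw hφ.continuous, Complex.real_smul, ← integral_complex_ofReal,
    ← integral_mul_const]
  have hcont : Continuous fun p : ℝ × ℝ =>
      ((rotPair R w φ (p.2 + p.1) * K p.2 : ℝ) : ℂ) * expKernel k p.1 := by fun_prop
  rw [integral_integral_swap
    (f := fun β α => ((rotPair R w φ (α + β) * K α : ℝ) : ℂ) * expKernel k β), multiplier,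
    ← integral_mul_const]
  · congr 1
    ext α
    have hper : Function.Periodic (fun β => (rotPair R w φ β : ℂ) * expKernel k β)
        (2 * Real.pi) := fun β => by
      simp [rotPair_add_two_pi, expKernel_add, expKernel_two_pi]
    -- Translating `β` by `α` over a period leaves behind the factor `e^{ikα}`, which is the
    -- exponential in `multiplier`.
    rw [← integral_angleMeasure_add hper α, ← integral_const_mul]
    congr 1
    ext β
    have : expKernel k (β + α) * expKernel (-k) α = expKernel k β := by
      rw [expKernel_add, mul_assoc]
      have : expKernel k α * expKernel (-k) α = 1 := by
        rw [expKernel, expKernel, ← Complex.exp_add]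
        simp
      rw [this, mul_one]
    rw [← this, add_comm α β]
    push_cast
    ring
  · have : IntegrableOn (fun p : ℝ × ℝ =>
      ((rotPair R w φ (p.2 + p.1) * K p.2 : ℝ) : ℂ) * expKernel k p.1)
        (Ioc 0 (2 * Real.pi) ×ˢ Ioc 0 (2 * Real.pi)) :=
      (hcont.continuousOn.integrableOn_compact (isCompact_Icc.prod isCompact_Icc)).mono_set
        (prod_mono Ioc_subset_Icc_self Ioc_subset_Icc_self)
    rwa [IntegrableOn, Measure.volume_eq_prod, ← Measure.prod_restrict] at this

/-! ### Partial derivatives of averages of rotates. -/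

theorem IsWeakPartial.integral_eq {Ω : Set Plane} {i : Fin 2} {u g φ : Plane → ℝ}
    (h : IsWeakPartial Ω i u g) (hφ : IsTestFunction Ω φ) :
    ∫ x in Ω, u x * fderiv ℝ φ x (EuclideanSpace.single i 1) = -∫ x in Ω, g x * φ x :=
  h.2.2 φ hφ.contDiff hφ.hasCompactSupport hφ.tsupport_subset

/-- The partial derivatives of an average of rotates, the basis vector `eᵢ` being rotated to
`a α e₀ + b α e₁`. -/
theorem isWeakPartial_rotAvg {K a b : ℝ → ℝ} (hK : Continuous K) (ha : Continuous a)
    (hb : Continuous b) {i : Fin 2}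
    (hab : ∀ α, rot α (EuclideanSpace.single i 1)
      = a α • EuclideanSpace.single 0 1 + b α • EuclideanSpace.single 1 1)
    {R : ℝ} {u u₀ u₁ : Plane → ℝ} (hu : MemLp u 2 (diskMeasure R))
    (hu₀ : MemLp u₀ 2 (diskMeasure R)) (hu₁ : MemLp u₁ 2 (diskMeasure R))
    (h₀ : IsWeakPartial (Metric.ball 0 R) 0 u u₀) (h₁ : IsWeakPartial (Metric.ball 0 R) 1 u u₁) :
    IsWeakPartial (Metric.ball 0 R) i (rotAvg K u)
      (rotAvg (fun α => K α * a α) u₀ + rotAvg (fun α => K α * b α) u₁) := by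
  have hKa : Continuous fun α => K α * a α := hK.mul ha
  have hKb : Continuous fun α => K α * b α := hK.mul hb
  have m₀ := memLp_rotAvg hKa hu₀
  have m₁ := memLp_rotAvg hKb hu₁
  refine ⟨locallyIntegrableOn_ball_of_memLp (memLp_rotAvg hK hu),
    locallyIntegrableOn_ball_of_memLp (m₀.add m₁), fun φ h1 h2 h3 => ?_⟩
  have hφ : IsTestFunction (Metric.ball 0 R) φ := ⟨h1, h2, h3⟩
  have hd : Differentiable ℝ φ := hφ.contDiff.differentiable (by simp)
  have hDc : Continuous fun x => fderiv ℝ φ x (EuclideanSpace.single i 1) :=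
    hφ.continuous_fderiv.clm_apply continuous_const
  -- By the chain rule, the `eᵢ`-derivative of `φ` at `rot (-α) x` is the derivative at `x` of the
  -- rotated `φ` in the direction `rot α eᵢ`; the two weak partials of `u` then apply.
  have hpair (α : ℝ) : rotPair R u (fun x => fderiv ℝ φ x (EuclideanSpace.single i 1)) α
      = -(a α * rotPair R u₀ φ α + b α * rotPair R u₁ φ α) := by
    have hφα := hφ.comp_rot (-α)
    have hc (j : Fin 2) : Continuous fun x =>
        fderiv ℝ (fun x => φ (rot (-α) x)) x (EuclideanSpace.single j 1) :=
      hφα.continuous_fderiv.clm_apply continuous_const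
    have hx (x : Plane) : fderiv ℝ φ (rot (-α) x) (EuclideanSpace.single i 1)
        = a α * fderiv ℝ (fun x => φ (rot (-α) x)) x (EuclideanSpace.single 0 1)
          + b α * fderiv ℝ (fun x => φ (rot (-α) x)) x (EuclideanSpace.single 1 1) := by
      rw [← smul_eq_mul, ← smul_eq_mul, ← map_smul, ← map_smul, ← map_add, ← hab,
        fderiv_comp_rot hd, rot_neg_rot]
    have e₀ := h₀.integral_eq hφα
    have e₁ := h₁.integral_eq hφα
    simp only [rotPair]
    simp_rw [hx, mul_add, mul_left_comm (u _)]
    rw [integral_add ((integrable_mul_continuous hu (hc 0)).const_mul _)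
      ((integrable_mul_continuous hu (hc 1)).const_mul _), integral_const_mul, integral_const_mul,
      e₀, e₁]
    ring
  have hl := integral_smul_rotAvg hK hu hDc
  have r₀ := integral_smul_rotAvg hKa hu₀ hφ.continuous
  have r₁ := integral_smul_rotAvg hKb hu₁ hφ.continuous
  have hint {v : Plane → ℝ} (hv : MemLp v 2 (diskMeasure R)) {c : ℝ → ℝ} (hc : Continuous c) :
      Integrable (fun α => rotPair R v φ α * c α) angleMeasure :=
    (((continuous_rotPair hv hφ.continuous).mul hc).integrableOn_Icc
      (a := 0) (b := 2 * Real.pi)).mono_set Ioc_subset_Icc_self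
  simp only [smul_eq_mul] at hl r₀ r₁
  simp_rw [mul_comm (rotAvg K u _), Pi.add_apply, add_mul]
  rw [integral_add (integrable_mul_continuous m₀ hφ.continuous)
    (integrable_mul_continuous m₁ hφ.continuous)]
  simp_rw [mul_comm _ (φ _)]
  rw [hl, r₀, r₁, ← integral_add (hint hu₀ hKa) (hint hu₁ hKb), ← integral_neg]
  congr 1
  ext α
  rw [hpair]
  ring

/-! ### Parseval on circles and comparison of `L²` norms. -/

theorem rotAvg_expKernel_eq_fourierCoeffOn (k : ℤ) (w : Plane → ℝ) (x : Plane) :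
    rotAvg (expKernel k) w x = (2 * Real.pi : ℝ) •
      fourierCoeffOn Real.two_pi_pos (fun α => ((w (rot α x) : ℝ) : ℂ)) k := by
  rw [fourierCoeffOn_eq_integral, rotAvg, integral_angleMeasure, smul_smul]
  have : 2 * Real.pi * (1 / (2 * Real.pi - 0)) = 1 := by
    field_simp
    simp
  rw [this, one_smul]
  congr 1
  ext α
  rw [fourier_coe_apply, smul_eq_mul, Complex.real_smul, mul_comm, expKernel]
  congr 2
  have : (Real.pi : ℂ) ≠ 0 := by exact_mod_cast Real.pi_ne_zero
  push_cast
  field_simp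
  simp only [sub_zero]
  ring

/-- Parseval on the circle through `x`, compared term by term. -/
theorem integral_sq_slice_le {w h : Plane → ℝ} {x : Plane} {δ : ℝ}
    (hw : MemLp (fun α => w (rot α x)) 2 angleMeasure)
    (hh : MemLp (fun α => h (rot α x)) 2 angleMeasure)
    (hc : ∀ k, ‖rotAvg (expKernel k) w x‖ ≤ δ * ‖rotAvg (expKernel k) h x‖) :
    ∫ α, w (rot α x) ^ 2 ∂angleMeasure ≤ δ ^ 2 * ∫ α, h (rot α x) ^ 2 ∂angleMeasure := by
  have hpi := Real.two_pi_pos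
  have hsw := hasSum_sq_fourierCoeffOn hpi hw.ofReal
  have hsh := (hasSum_sq_fourierCoeffOn hpi hh.ofReal).mul_left (δ ^ 2)
  have hle := hasSum_le (fun k => ?_) hsw hsh
  · simp only [RCLike.norm_ofReal, sq_abs, smul_eq_mul, ← integral_angleMeasure, sub_zero] at hle
    rw [mul_left_comm] at hle
    exact le_of_mul_le_mul_left hle (by positivity)
  · have := hc k
    rw [rotAvg_expKernel_eq_fourierCoeffOn, rotAvg_expKernel_eq_fourierCoeffOn, norm_smul,
      norm_smul, mul_left_comm, Real.norm_of_nonneg hpi.le] at this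
    rw [← mul_pow]
    exact pow_le_pow_left₀ (norm_nonneg _) (le_of_mul_le_mul_left this hpi) 2

theorem normL2_eq_sqrt {Ω : Set Plane} {w : Plane → ℝ} (hw : MemLp w 2 (volume.restrict Ω)) :
    normL2 Ω w = √(∫ x in Ω, w x ^ 2) := by
  rw [normL2, hw.eLpNorm_eq_integral_rpow_norm two_ne_zero ENNReal.ofNat_ne_top,
    ENNReal.toReal_ofReal (by positivity), Real.sqrt_eq_rpow]
  simp

/-- Comparing angular Fourier coefficients compares the `L²` norms on the disk. -/
theorem normL2_le_of_coeff_le {R δ : ℝ} {w h : Plane → ℝ} (hδ : 0 ≤ δ)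
    (hw : MemLp w 2 (diskMeasure R)) (hh : MemLp h 2 (diskMeasure R))
    (hc : ∀ k, ∀ᵐ x ∂diskMeasure R,
      ‖rotAvg (expKernel k) w x‖ ≤ δ * ‖rotAvg (expKernel k) h x‖) :
    normL2 (Metric.ball 0 R) w ≤ δ * normL2 (Metric.ball 0 R) h := by
  have hsq {v : Plane → ℝ} (hv : MemLp v 2 (diskMeasure R)) :
      Integrable (fun x => ∫ α, v (rot α x) ^ 2 ∂angleMeasure) (diskMeasure R) :=
    (memLp_comp_rot hv).integrable_sq.integral_prod_right
  have hle : ∫ x, (∫ α, w (rot α x) ^ 2 ∂angleMeasure) ∂diskMeasure R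
      ≤ ∫ x, δ ^ 2 * (∫ α, h (rot α x) ^ 2 ∂angleMeasure) ∂diskMeasure R := by
    refine integral_mono_ae (hsq hw) ((hsq hh).const_mul _) ?_
    filter_upwards [ae_memLp_slice hw, ae_memLp_slice hh, ae_all_iff.2 hc] with x h1 h2 h3
    exact integral_sq_slice_le h1 h2 h3
  rw [integral_const_mul, integral_integral_sq_slice hw, integral_integral_sq_slice hh,
    mul_left_comm] at hle
  have hle' := le_of_mul_le_mul_left hle Real.two_pi_pos
  rw [normL2_eq_sqrt hw, normL2_eq_sqrt hh, ← Real.sqrt_sq hδ, ← Real.sqrt_mul (sq_nonneg δ)]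
  exact Real.sqrt_le_sqrt hle'

/-! ### The Dirichlet kernel and its multipliers. -/

/-- The Dirichlet kernel. -/
def dirichletKernel (J : ℕ) (α : ℝ) : ℝ :=
  1 / (2 * Real.pi) + ∑ j ∈ Finset.Icc 1 J, 1 / Real.pi * Real.cos (j * α)

theorem continuous_dirichletKernel (J : ℕ) : Continuous (dirichletKernel J) := by
  unfold dirichletKernel
  fun_prop

theorem integral_expKernel (k : ℤ) :
    ∫ α, expKernel k α ∂angleMeasure = if k = 0 then 2 * (Real.pi : ℂ) else 0 := by
  split_ifs with hk
  · subst hk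
    simp [expKernel, Real.pi_pos.le]
  · have hk' : -((k : ℂ) * Complex.I) ≠ 0 := by simpa using hk
    have h := intervalIntegral.integral_eq_sub_of_hasDerivAt (a := 0) (b := 2 * Real.pi)
      (fun α _ => hasDerivAt_expKernel k α)
      (((continuous_expKernel k).const_mul _).intervalIntegrable _ _)
    rw [expKernel_two_pi, expKernel_zero, sub_self, intervalIntegral.integral_const_mul,
      ← integral_angleMeasure] at h
    exact (mul_eq_zero.1 h).resolve_left hk'

theorem integrable_angle_of_continuous {E : Type*} [NormedAddCommGroup E] {f : ℝ → E}
    (hf : Continuous f) : Integrable f angleMeasure :=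
  (hf.integrableOn_Icc (a := 0) (b := 2 * Real.pi)).mono_set Ioc_subset_Icc_self

theorem ofReal_cos_mul_expKernel (j k : ℤ) (α : ℝ) :
    (Real.cos (j * α) : ℂ) * expKernel k α
      = (1 / 2 : ℂ) * expKernel (k - j) α + (1 / 2 : ℂ) * expKernel (k + j) α := by
  rw [Complex.ofReal_cos, Complex.cos, expKernel, expKernel, expKernel, div_mul_eq_mul_div, add_mul,
    ← Complex.exp_add, ← Complex.exp_add]
  push_cast
  ring_nf

theorem ofReal_sin_mul_expKernel (k : ℤ) (α : ℝ) :
    (Real.sin α : ℂ) * expKernel k α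
      = (Complex.I / 2) * expKernel (k + 1) α + -(Complex.I / 2) * expKernel (k - 1) α := by
  rw [Complex.ofReal_sin, Complex.sin, expKernel, expKernel, expKernel, div_mul_eq_mul_div,
    mul_right_comm, sub_mul, ← Complex.exp_add, ← Complex.exp_add]
  push_cast
  ring_nf

theorem multiplier_add {K L : ℝ → ℝ} (hK : Continuous K) (hL : Continuous L) (k : ℤ) :
    multiplier (fun α => K α + L α) k = multiplier K k + multiplier L k := by
  have he := continuous_expKernel (-k)
  rw [multiplier, multiplier, multiplier,
    ← integral_add (integrable_angle_of_continuous (by fun_prop))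
      (integrable_angle_of_continuous (by fun_prop))]
  simp_rw [Complex.ofReal_add, add_mul]

/-- Orthogonality of exponentials leaves only the frequencies `±j`. The case `j = 0` is excluded
because the two would coincide and double the value. -/
theorem multiplier_cos (j : ℕ) (hj : 1 ≤ j) (k : ℤ) :
    multiplier (fun α => 1 / Real.pi * Real.cos (j * α)) k = if |k| = j then 1 else 0 := by
  have he := continuous_expKernel
  have hpi : (Real.pi : ℂ) ≠ 0 := by exact_mod_cast Real.pi_ne_zero
  have h (α : ℝ) : ((1 / Real.pi * Real.cos (j * α) : ℝ) : ℂ) * expKernel (-k) α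
      = 1 / Real.pi * ((1 / 2 : ℂ) * expKernel (-k - j) α + (1 / 2 : ℂ) * expKernel (-k + j) α) := by
    rw [← ofReal_cos_mul_expKernel]
    push_cast
    ring
  rw [multiplier]
  simp_rw [h]
  rw [integral_const_mul, integral_add (integrable_angle_of_continuous (by fun_prop))
    (integrable_angle_of_continuous (by fun_prop)), integral_const_mul, integral_const_mul,
    integral_expKernel, integral_expKernel]
  rcases lt_trichotomy k 0 with hk | hk | hk
  · rw [abs_of_neg hk, if_neg (by omega : ¬ -k + (j : ℤ) = 0)]
    split_ifs <;> first | omega | (field_simp; simp)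
  · subst hk
    rw [if_neg (by omega), if_neg (by omega), if_neg (by simp; omega)]
    simp
  · rw [abs_of_pos hk, if_neg (by omega : ¬ -k - (j : ℤ) = 0)]
    split_ifs <;> first | omega | (field_simp; simp)

theorem multiplier_dirichletKernel (J : ℕ) (k : ℤ) :
    multiplier (dirichletKernel J) k = if |k| ≤ J then 1 else 0 := by
  have hpi : (Real.pi : ℂ) ≠ 0 := by exact_mod_cast Real.pi_ne_zero
  induction J with
  | zero =>
    have h (α : ℝ) : ((dirichletKernel 0 α : ℝ) : ℂ) * expKernel (-k) α
        = 1 / (2 * Real.pi) * expKernel (-k) α := by simp [dirichletKernel]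
    rw [multiplier]
    simp_rw [h]
    rw [integral_const_mul, integral_expKernel]
    by_cases hk : k = 0
    · simp [hk]
      field_simp
    · simp [hk]
  | succ J ih =>
    have h : dirichletKernel (J + 1) = fun α => dirichletKernel J α
        + 1 / Real.pi * Real.cos ((J + 1 : ℕ) * α) := by
      ext α
      rw [dirichletKernel, dirichletKernel, Finset.sum_Icc_succ_top (by omega), add_assoc]
    rw [h, multiplier_add (continuous_dirichletKernel J) (by fun_prop), ih,
      multiplier_cos _ (by omega)]
    push_cast
    split_ifs <;> first | omega | simp

/-- By Euler's formula, a factor `cos α` or `sin α` in the kernel shifts the frequency by one in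
each direction. -/
theorem multiplier_mul_cos {K : ℝ → ℝ} (hK : Continuous K) (k : ℤ) :
    multiplier (fun α => K α * Real.cos α) k
      = 1 / 2 * multiplier K (k + 1) + 1 / 2 * multiplier K (k - 1) := by
  have he := continuous_expKernel
  rw [multiplier, multiplier, multiplier, ← integral_const_mul, ← integral_const_mul,
    ← integral_add (integrable_angle_of_continuous (by fun_prop))
      (integrable_angle_of_continuous (by fun_prop))]
  congr 1
  ext α
  have := ofReal_cos_mul_expKernel 1 (-k) α
  rw [Int.cast_one, one_mul] at this
  rw [Complex.ofReal_mul, mul_assoc, this]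
  ring_nf

theorem multiplier_mul_sin {K : ℝ → ℝ} (hK : Continuous K) (k : ℤ) :
    multiplier (fun α => K α * Real.sin α) k
      = Complex.I / 2 * multiplier K (k - 1) + -(Complex.I / 2) * multiplier K (k + 1) := by
  have he := continuous_expKernel
  rw [multiplier, multiplier, multiplier, ← integral_const_mul, ← integral_const_mul,
    ← integral_add (integrable_angle_of_continuous (by fun_prop))
      (integrable_angle_of_continuous (by fun_prop))]
  congr 1
  ext α
  rw [Complex.ofReal_mul, mul_assoc, ofReal_sin_mul_expKernel]
  ring_nf

/-! ### The truncation as an average of rotates. -/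

theorem integral_polarPoint_mul (u : Plane → ℝ) (x : Plane) {G : ℝ → ℝ}
    (hG : Function.Periodic G (2 * Real.pi)) :
    ∫ θ in (0 : ℝ)..2 * Real.pi, u (polarPoint ‖x‖ θ) * G θ
      = ∫ α, u (rot α x) * G (α + angle x) ∂angleMeasure := by
  have hper : Function.Periodic (fun θ => u (polarPoint ‖x‖ θ) * G θ) (2 * Real.pi) := fun θ => by
    simp [polarPoint, hG θ]
  rw [← integral_angleMeasure, ← integral_angleMeasure_add hper (angle x)]
  simp_rw [← rot_polarPoint, polarPoint_norm_angle]

/-- The truncated expansion is the average of the rotates against the Dirichlet kernel. -/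
theorem truncation_ae_eq_rotAvg {R : ℝ} {u : Plane → ℝ} (hu : MemLp u 2 (diskMeasure R)) (J : ℕ) :
    truncation u J =ᵐ[diskMeasure R] rotAvg (dirichletKernel J) u := by
  filter_upwards [ae_memLp_slice hu] with x hx
  have hint {G : ℝ → ℝ} (hG : Continuous G) :
      Integrable (fun α => u (rot α x) * G α) angleMeasure := by
    obtain ⟨C, -, hC⟩ := exists_bound_angle hG
    exact (hx.integrable one_le_two).mul_bdd (c := C) hG.aestronglyMeasurable hC
  have hper (f : ℝ → ℝ) (hf : Function.Periodic f (2 * Real.pi)) (j : ℕ) :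
      Function.Periodic (fun θ => f (j * θ)) (2 * Real.pi) := fun θ => by
    simpa [mul_add] using hf.nat_mul j (j * θ)
  have hcos (j : ℕ) := integral_polarPoint_mul u x (hper _ Real.cos_periodic j)
  have hsin (j : ℕ) := integral_polarPoint_mul u x (hper _ Real.sin_periodic j)
  have hone := integral_polarPoint_mul u x (G := fun _ => 1) fun _ => rfl
  simp only [mul_one] at hone
  have hterm (j : ℕ) : coeffCos u j ‖x‖ * Real.cos (j * angle x)
      + coeffSin u j ‖x‖ * Real.sin (j * angle x)
      = ∫ α, u (rot α x) * (1 / Real.pi * Real.cos (j * α)) ∂angleMeasure := by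
    rw [coeffCos, coeffSin, hcos, hsin, mul_assoc, mul_assoc, ← integral_mul_const,
      ← integral_mul_const, ← mul_add, ← integral_add, ← integral_const_mul]
    · congr 1
      ext α
      -- Only the difference between the integration angle and the angle of `x` survives, so the
      -- choice of angle for `x` drops out.
      have : Real.cos (j * α) = Real.cos (j * (α + angle x)) * Real.cos (j * angle x)
          + Real.sin (j * (α + angle x)) * Real.sin (j * angle x) := by
        rw [← Real.cos_sub]
        congr 1
        ring
      rw [this]
      ring
    · exact (hint (by fun_prop)).mul_const _
    · exact (hint (by fun_prop)).mul_const _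
  rw [truncation, truncationPolar, Finset.sum_congr rfl fun j _ => hterm j, coeffZero, hone,
    ← integral_const_mul, ← integral_finsetSum _ fun j _ => hint (by fun_prop), ← integral_add]
  · rw [rotAvg]
    congr 1
    ext α
    rw [dirichletKernel, smul_eq_mul, mul_add, Finset.mul_sum, mul_comm (1 / _)]
  · exact ((hx.integrable one_le_two).const_mul _)
  · exact integrable_finsetSum _ fun j _ => hint (by fun_prop)

/-! ### Coordinate multiplication, `L²` norms and calculus of the angular derivative. -/

theorem contDiff_coord (i : Fin 2) : ContDiff ℝ ∞ fun x : Plane => x i := by fun_prop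

theorem fderiv_coord_mul {φ : Plane → ℝ} (hφ : Differentiable ℝ φ) (i : Fin 2) (x v : Plane) :
    fderiv ℝ (fun x => x i * φ x) x v = x i * fderiv ℝ φ x v + v i * φ x := by
  have h1 : HasFDerivAt (fun x : Plane => x i) (EuclideanSpace.proj i : Plane →L[ℝ] ℝ) x :=
    (EuclideanSpace.proj i : Plane →L[ℝ] ℝ).hasFDerivAt
  have h2 : HasFDerivAt (fun x : Plane => x i * φ x) _ x := h1.mul (hφ x).hasFDerivAt
  rw [h2.fderiv]
  simp [mul_comm]

theorem memLp_coord_mul {R : ℝ} {w : Plane → ℝ} (hw : MemLp w 2 (diskMeasure R)) (i : Fin 2) :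
    MemLp (fun x => x i * w x) 2 (diskMeasure R) := by
  refine hw.of_le_mul (c := R) ((contDiff_coord i).continuous.aestronglyMeasurable.mul
    hw.aestronglyMeasurable) ?_
  filter_upwards [ae_restrict_mem measurableSet_ball] with x hx
  rw [norm_mul]
  gcongr
  exact (PiLp.norm_apply_le x i).trans (mem_ball_zero_iff.1 hx).le

theorem normL2_coord_mul_le {R : ℝ} (hR : 0 ≤ R) {w : Plane → ℝ}
    (hw : MemLp w 2 (diskMeasure R)) (i : Fin 2) :
    normL2 (Metric.ball 0 R) (fun x => x i * w x) ≤ R * normL2 (Metric.ball 0 R) w := by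
  rw [normL2_eq_sqrt (memLp_coord_mul hw i), normL2_eq_sqrt hw]
  nth_rw 2 [← Real.sqrt_sq hR]
  rw [← Real.sqrt_mul (sq_nonneg R), ← integral_const_mul]
  refine Real.sqrt_le_sqrt (integral_mono_ae (memLp_coord_mul hw i).integrable_sq
    (hw.integrable_sq.const_mul _) ?_)
  filter_upwards [ae_restrict_mem measurableSet_ball] with x hx
  rw [mul_pow]
  gcongr ?_ * _
  rw [← sq_abs]
  gcongr
  exact (PiLp.norm_apply_le x i).trans (mem_ball_zero_iff.1 hx).le

theorem normL2_add_le {Ω : Set Plane} {v w : Plane → ℝ} (hv : MemLp v 2 (volume.restrict Ω))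
    (hw : MemLp w 2 (volume.restrict Ω)) : normL2 Ω (v + w) ≤ normL2 Ω v + normL2 Ω w := by
  rw [normL2, normL2, normL2, ← ENNReal.toReal_add hv.eLpNorm_ne_top hw.eLpNorm_ne_top]
  exact ENNReal.toReal_mono (ENNReal.add_ne_top.2 ⟨hv.eLpNorm_ne_top, hw.eLpNorm_ne_top⟩)
    (eLpNorm_add_le hv.1 hw.1 one_le_two)

theorem normL2_neg (Ω : Set Plane) (w : Plane → ℝ) : normL2 Ω (-w) = normL2 Ω w := by
  rw [normL2, normL2, eLpNorm_neg]

theorem normL2_sub_le {Ω : Set Plane} {v w : Plane → ℝ} (hv : MemLp v 2 (volume.restrict Ω))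
    (hw : MemLp w 2 (volume.restrict Ω)) : normL2 Ω (v - w) ≤ normL2 Ω v + normL2 Ω w := by
  rw [sub_eq_add_neg, ← normL2_neg Ω w]
  exact normL2_add_le hv hw.neg

theorem normL2_congr {Ω : Set Plane} {v w : Plane → ℝ} (h : v =ᵐ[volume.restrict Ω] w) :
    normL2 Ω v = normL2 Ω w := by
  rw [normL2, normL2, eLpNorm_congr_ae h]

theorem normL2_nonneg (Ω : Set Plane) (w : Plane → ℝ) : 0 ≤ normL2 Ω w := ENNReal.toReal_nonneg

/-- The angular derivative in terms of the partial derivatives. -/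
theorem isAngularDeriv_of_isWeakPartial {R : ℝ} {u u₀ u₁ : Plane → ℝ}
    (hu : MemLp u 2 (diskMeasure R))
    (hu₀ : MemLp u₀ 2 (diskMeasure R)) (hu₁ : MemLp u₁ 2 (diskMeasure R))
    (h₀ : IsWeakPartial (Metric.ball 0 R) 0 u u₀) (h₁ : IsWeakPartial (Metric.ball 0 R) 1 u u₁) :
    IsAngularDeriv (Metric.ball 0 R) u ((fun x => x 0 * u₁ x) - fun x => x 1 * u₀ x) := by
  intro φ hφ
  have hd : Differentiable ℝ φ := hφ.contDiff.differentiable (by simp)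
  have t₀ := hφ.mul (contDiff_coord 0)
  have t₁ := hφ.mul (contDiff_coord 1)
  have e₁ := h₁.integral_eq t₀
  have e₀ := h₀.integral_eq t₁
  -- The rotation field is divergence free: `∂₁x₀ = ∂₀x₁ = 0`, so moving the coordinates into the
  -- test functions creates no extra terms.
  have hx (x : Plane) : u x * fderiv ℝ φ x (perp x)
      = u x * fderiv ℝ (fun x => x 0 * φ x) x (EuclideanSpace.single 1 1)
        - u x * fderiv ℝ (fun x => x 1 * φ x) x (EuclideanSpace.single 0 1) := by
    rw [fderiv_coord_mul hd, fderiv_coord_mul hd, perp_eq, map_sub, map_smul, map_smul]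
    simp
    ring
  have hy (x : Plane) : ((fun x => x 0 * u₁ x) - fun x => x 1 * u₀ x) x * φ x
      = u₁ x * (x 0 * φ x) - u₀ x * (x 1 * φ x) := by
    simp
    ring
  simp_rw [hx, hy]
  rw [integral_sub
      (integrable_mul_continuous hu (t₀.continuous_fderiv.clm_apply continuous_const))
      (integrable_mul_continuous hu (t₁.continuous_fderiv.clm_apply continuous_const)),
    integral_sub (integrable_mul_continuous hu₁ t₀.continuous)
      (integrable_mul_continuous hu₀ t₁.continuous), e₀, e₁]
  ring

theorem IsAngularDeriv.sub {R : ℝ} {v w f g : Plane → ℝ} (hv : MemLp v 2 (diskMeasure R))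
    (hw : MemLp w 2 (diskMeasure R)) (hf : MemLp f 2 (diskMeasure R))
    (hg : MemLp g 2 (diskMeasure R)) (hvf : IsAngularDeriv (Metric.ball 0 R) v f)
    (hwg : IsAngularDeriv (Metric.ball 0 R) w g) :
    IsAngularDeriv (Metric.ball 0 R) (v - w) (f - g) := by
  intro φ hφ
  have hc := hφ.continuous_fderiv.clm_apply continuous_perp
  simp_rw [Pi.sub_apply, sub_mul]
  rw [integral_sub (integrable_mul_continuous hv hc) (integrable_mul_continuous hw hc),
    integral_sub (integrable_mul_continuous hf hφ.continuous)
      (integrable_mul_continuous hg hφ.continuous), hvf φ hφ, hwg φ hφ]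
  ring

/-- The product rule for the angular derivative and a coordinate function. -/
theorem IsAngularDeriv.coord_mul {R : ℝ} {w g : Plane → ℝ} (hw : MemLp w 2 (diskMeasure R))
    (hg : MemLp g 2 (diskMeasure R)) (hwg : IsAngularDeriv (Metric.ball 0 R) w g) (i : Fin 2) :
    IsAngularDeriv (Metric.ball 0 R) (fun x => x i * w x)
      ((fun x => x i * g x) + fun x => perp x i * w x) := by
  intro φ hφ
  have hd : Differentiable ℝ φ := hφ.contDiff.differentiable (by simp)
  have ht := hφ.mul (contDiff_coord i)
  have hp : Continuous fun x => perp x i * φ x :=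
    ((contDiff_coord i).continuous.comp continuous_perp).mul hφ.continuous
  have hx (x : Plane) : x i * w x * fderiv ℝ φ x (perp x)
      = w x * fderiv ℝ (fun x => x i * φ x) x (perp x) - w x * (perp x i * φ x) := by
    rw [fderiv_coord_mul hd]
    ring
  have hy (x : Plane) : ((fun x => x i * g x) + fun x => perp x i * w x) x * φ x
      = g x * (x i * φ x) + w x * (perp x i * φ x) := by
    simp
    ring
  simp_rw [hx, hy]
  rw [integral_sub
      (integrable_mul_continuous hw (ht.continuous_fderiv.clm_apply continuous_perp))
      (integrable_mul_continuous hw hp), hwg _ ht,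
    integral_add (integrable_mul_continuous hg ht.continuous) (integrable_mul_continuous hw hp)]
  ring

/-! ### Weak partial derivatives and Sobolev norms. -/

/-- Weak derivatives are only assumed locally integrable; the compact support of `φ` inside the open
disk makes the product integrable. -/
theorem integrable_test_smul {R : ℝ} {f φ : Plane → ℝ}
    (hf : LocallyIntegrableOn f (Metric.ball 0 R)) (hφ : IsTestFunction (Metric.ball 0 R) φ) :
    Integrable (fun x => f x * φ x) (diskMeasure R) := by
  have h1 : IntegrableOn f (tsupport φ) :=
    hf.integrableOn_compact_subset hφ.tsupport_subset hφ.hasCompactSupport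
  have h2 : IntegrableOn (fun x => f x * φ x) (tsupport φ) :=
    h1.mul_continuousOn hφ.continuous.continuousOn hφ.hasCompactSupport
  have h3 : Integrable (fun x => f x * φ x) := by
    refine (integrableOn_iff_integrable_of_support_subset ?_).1 h2
    exact (Function.support_mul_subset_right f φ).trans (subset_tsupport φ)
  exact h3.restrict

/-- Weak partial derivatives are unique. -/
theorem IsWeakPartial.ae_eq {R : ℝ} {i : Fin 2} {u f g : Plane → ℝ}
    (hf : IsWeakPartial (Metric.ball 0 R) i u f) (hg : IsWeakPartial (Metric.ball 0 R) i u g) :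
    f =ᵐ[diskMeasure R] g := by
  have h0 : f - g =ᵐ[diskMeasure R] 0 := by
    refine ae_eq_zero_of_integral_test (hf.2.1.sub hg.2.1) fun φ hφ => ?_
    simp_rw [smul_eq_mul, mul_comm (φ _), Pi.sub_apply, sub_mul]
    rw [integral_sub (integrable_test_smul hf.2.1 hφ) (integrable_test_smul hg.2.1 hφ), sub_eq_zero,
      ← neg_inj, ← hf.integral_eq hφ, ← hg.integral_eq hφ]
  filter_upwards [h0] with x hx
  exact sub_eq_zero.1 hx

theorem IsWeakPartial.congr_ae {R : ℝ} {i : Fin 2} {u v g : Plane → ℝ}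
    (h : IsWeakPartial (Metric.ball 0 R) i u g) (huv : u =ᵐ[diskMeasure R] v)
    (hv : MemLp v 2 (diskMeasure R)) : IsWeakPartial (Metric.ball 0 R) i v g := by
  refine ⟨locallyIntegrableOn_ball_of_memLp hv, h.2.1, fun φ h1 h2 h3 => ?_⟩
  rw [← h.2.2 φ h1 h2 h3]
  refine integral_congr_ae ?_
  filter_upwards [huv] with x hx
  rw [hx]

theorem IsWeakPartial.sub {R : ℝ} {i : Fin 2} {u v f g : Plane → ℝ}
    (hu : MemLp u 2 (diskMeasure R)) (hv : MemLp v 2 (diskMeasure R))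
    (huf : IsWeakPartial (Metric.ball 0 R) i u f) (hvg : IsWeakPartial (Metric.ball 0 R) i v g) :
    IsWeakPartial (Metric.ball 0 R) i (u - v) (f - g) := by
  refine ⟨huf.1.sub hvg.1, huf.2.1.sub hvg.2.1, fun φ h1 h2 h3 => ?_⟩
  have hφ : IsTestFunction (Metric.ball 0 R) φ := ⟨h1, h2, h3⟩
  have hc : Continuous fun x => fderiv ℝ φ x (EuclideanSpace.single i 1) :=
    hφ.continuous_fderiv.clm_apply continuous_const
  simp_rw [Pi.sub_apply, sub_mul]
  rw [integral_sub (integrable_mul_continuous hu hc) (integrable_mul_continuous hv hc),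
    integral_sub (integrable_test_smul huf.2.1 hφ) (integrable_test_smul hvg.2.1 hφ),
    huf.integral_eq hφ, hvg.integral_eq hφ]
  ring

theorem isWeakPartial_weakPartial {Ω : Set Plane} {i : Fin 2} {u : Plane → ℝ}
    (h : ∃ g, IsWeakPartial Ω i u g) : IsWeakPartial Ω i u (weakPartial Ω i u) := by
  rw [weakPartial, dif_pos h]
  exact h.choose_spec

/-- `weakPartial` is an arbitrary choice; by uniqueness its norm can be computed from any explicit
weak derivative. -/
theorem IsWeakPartial.weakPartial_ae_eq {R : ℝ} {i : Fin 2} {u g : Plane → ℝ}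
    (h : IsWeakPartial (Metric.ball 0 R) i u g) :
    weakPartial (Metric.ball 0 R) i u =ᵐ[diskMeasure R] g :=
  (isWeakPartial_weakPartial ⟨g, h⟩).ae_eq h

theorem MemH1.isWeakPartial {R : ℝ} {u : Plane → ℝ} (h : MemH1 (Metric.ball 0 R) u) (i : Fin 2) :
    IsWeakPartial (Metric.ball 0 R) i u (weakPartial (Metric.ball 0 R) i u) := by
  obtain ⟨g, hg, -⟩ := h.2 i
  exact isWeakPartial_weakPartial ⟨g, hg⟩

theorem MemH1.memLp_weakPartial {R : ℝ} {u : Plane → ℝ} (h : MemH1 (Metric.ball 0 R) u)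
    (i : Fin 2) : MemLp (weakPartial (Metric.ball 0 R) i u) 2 (diskMeasure R) := by
  obtain ⟨g, hg, hg2⟩ := h.2 i
  exact MemLp.ae_eq hg.weakPartial_ae_eq.symm hg2

theorem MemH1.congr_ae {R : ℝ} {u v : Plane → ℝ} (h : MemH1 (Metric.ball 0 R) u)
    (huv : u =ᵐ[diskMeasure R] v) : MemH1 (Metric.ball 0 R) v := by
  have hv : MemLp v 2 (diskMeasure R) := MemLp.ae_eq huv h.1
  refine ⟨hv, fun i => ?_⟩
  obtain ⟨g, hg, hg2⟩ := h.2 i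
  exact ⟨g, hg.congr_ae huv hv, hg2⟩

theorem MemH2.memH1 {Ω : Set Plane} {u : Plane → ℝ} (h : MemH2 Ω u) : MemH1 Ω u :=
  ⟨h.1, fun i => (h.2 i).imp fun _ hg => ⟨hg.1, hg.2.1⟩⟩

theorem MemH2.memH1_weakPartial {R : ℝ} {u : Plane → ℝ} (h : MemH2 (Metric.ball 0 R) u)
    (i : Fin 2) : MemH1 (Metric.ball 0 R) (weakPartial (Metric.ball 0 R) i u) := by
  obtain ⟨g, hg, hg2⟩ := h.2 i
  exact hg2.congr_ae hg.weakPartial_ae_eq.symm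

theorem normL2_weakPartial_le_normH2 (Ω : Set Plane) (u : Plane → ℝ) (i : Fin 2) :
    normL2 Ω (weakPartial Ω i u) ≤ normH2 Ω u := by
  refine Real.le_sqrt_of_sq_le ?_
  have h1 := Finset.single_le_sum (f := fun i => normL2 Ω (weakPartial Ω i u) ^ 2)
    (fun i _ => sq_nonneg _) (Finset.mem_univ i)
  have h2 : 0 ≤ ∑ i, ∑ j, normL2 Ω (weakPartial Ω j (weakPartial Ω i u)) ^ 2 :=
    Finset.sum_nonneg fun i _ => Finset.sum_nonneg fun j _ => sq_nonneg _
  have h3 := sq_nonneg (normL2 Ω u)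
  linarith

theorem normL2_weakPartial_weakPartial_le_normH2 (Ω : Set Plane) (u : Plane → ℝ) (i j : Fin 2) :
    normL2 Ω (weakPartial Ω j (weakPartial Ω i u)) ≤ normH2 Ω u := by
  refine Real.le_sqrt_of_sq_le ?_
  have h1 := Finset.single_le_sum
    (f := fun j => normL2 Ω (weakPartial Ω j (weakPartial Ω i u)) ^ 2)
    (fun j _ => sq_nonneg _) (Finset.mem_univ j)
  have h2 := Finset.single_le_sum
    (f := fun i => ∑ j, normL2 Ω (weakPartial Ω j (weakPartial Ω i u)) ^ 2)
    (fun i _ => Finset.sum_nonneg fun j _ => sq_nonneg _) (Finset.mem_univ i)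
  have h3 : 0 ≤ ∑ i, normL2 Ω (weakPartial Ω i u) ^ 2 := Finset.sum_nonneg fun i _ => sq_nonneg _
  have h4 := sq_nonneg (normL2 Ω u)
  linarith

theorem normH1_le (Ω : Set Plane) (u : Plane → ℝ) :
    normH1 Ω u ≤ normL2 Ω u + ∑ i, normL2 Ω (weakPartial Ω i u) := by
  have h (i : Fin 2) := normL2_nonneg Ω (weakPartial Ω i u)
  have h0 := normL2_nonneg Ω u
  rw [normH1, Fin.sum_univ_two, Fin.sum_univ_two]
  refine Real.sqrt_le_iff.2 ⟨by linarith [h 0, h 1], ?_⟩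
  nlinarith [mul_nonneg h0 (h 0), mul_nonneg h0 (h 1), mul_nonneg (h 0) (h 1)]

/-! ### From multiplier bounds to `L²` error bounds. -/

theorem rotAvg_expKernel_sub_smul {R : ℝ} {v w : Plane → ℝ} (hv : MemLp v 2 (diskMeasure R))
    (hw : MemLp w 2 (diskMeasure R)) (ε : ℝ) (k : ℤ) : ∀ᵐ x ∂diskMeasure R,
      rotAvg (expKernel k) (v - ε • w) x
        = rotAvg (expKernel k) v x - ε * rotAvg (expKernel k) w x := by
  obtain ⟨C, -, hC⟩ := exists_bound_angle (continuous_expKernel k)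
  have hm := (continuous_expKernel k).aestronglyMeasurable (μ := angleMeasure)
  filter_upwards [ae_memLp_slice hv, ae_memLp_slice hw] with x h1 h2
  have i1 : Integrable (fun α => v (rot α x) • expKernel k α) angleMeasure :=
    (h1.integrable one_le_two).smul_bdd C hm hC
  have i2 : Integrable (fun α => w (rot α x) • expKernel k α) angleMeasure :=
    (h2.integrable one_le_two).smul_bdd C hm hC
  rw [rotAvg, rotAvg, rotAvg, ← integral_const_mul, ← integral_sub i1 (i2.const_mul _)]
  congr 1
  ext α
  simp only [Pi.sub_apply, Pi.smul_apply, smul_eq_mul, Complex.real_smul]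
  push_cast
  ring

/-- Comparing the average of rotates `rotAvg K w` with `ε w` through the multipliers. -/
theorem normL2_rotAvg_sub_smul_le {K : ℝ → ℝ} (hK : Continuous K) {R δ ε : ℝ} (hδ : 0 ≤ δ)
    {w h : Plane → ℝ} (hw : MemLp w 2 (diskMeasure R)) (hh : MemLp h 2 (diskMeasure R))
    (hc : ∀ k, ∀ᵐ x ∂diskMeasure R, ‖multiplier K k - ε‖ * ‖rotAvg (expKernel k) w x‖
      ≤ δ * ‖rotAvg (expKernel k) h x‖) :
    normL2 (Metric.ball 0 R) (rotAvg K w - ε • w) ≤ δ * normL2 (Metric.ball 0 R) h := by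
  refine normL2_le_of_coeff_le hδ ((memLp_rotAvg hK hw).sub (hw.const_smul ε)) hh fun k => ?_
  filter_upwards [hc k, rotAvg_expKernel_sub_smul (memLp_rotAvg hK hw) hw ε k,
    rotAvg_expKernel_rotAvg hK hw k] with x h1 h2 h3
  rwa [h2, h3, ← sub_mul, norm_mul]

/-- The factor `|k|` in the hypothesis is absorbed by the coefficients of `g`, which are `ik` times
those of `w`. It is used with `ε = 1` for the cosine kernel and `ε = 0` for the sine kernel. -/
theorem normL2_rotAvg_sub_smul_le_angularDeriv {K : ℝ → ℝ} (hK : Continuous K) {R δ ε : ℝ}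
    (hδ : 0 ≤ δ) {w g : Plane → ℝ} (hw : MemLp w 2 (diskMeasure R))
    (hg : MemLp g 2 (diskMeasure R)) (hwg : IsAngularDeriv (Metric.ball 0 R) w g)
    (hc : ∀ k : ℤ, ‖multiplier K k - ε‖ ≤ δ * |(k : ℝ)|) :
    normL2 (Metric.ball 0 R) (rotAvg K w - ε • w) ≤ δ * normL2 (Metric.ball 0 R) g := by
  refine normL2_rotAvg_sub_smul_le hK hδ hw hg fun k => ?_
  filter_upwards [rotAvg_expKernel_angularDeriv hw hg hwg k] with x hx
  rw [hx, norm_mul, norm_mul, Complex.norm_I, mul_one, Complex.norm_intCast, ← mul_assoc]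
  exact mul_le_mul_of_nonneg_right (hc k) (norm_nonneg _)

theorem one_le_inv_mul_abs {J : ℕ} (hJ : 1 ≤ J) {k : ℤ} (hk : (J : ℤ) ≤ |k|) :
    (1 : ℝ) ≤ (J : ℝ)⁻¹ * |(k : ℝ)| := by
  have hJ' : (0 : ℝ) < J := by exact_mod_cast hJ
  rw [inv_mul_eq_div, one_le_div hJ']
  exact_mod_cast hk

/-- The error multiplier vanishes for `|k| ≤ J` and has norm `1 ≤ (|k|/J)²` beyond. -/
theorem norm_multiplier_dirichletKernel_sub_one_le {J : ℕ} (hJ : 1 ≤ J) (k : ℤ) :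
    ‖multiplier (dirichletKernel J) k - (1 : ℝ)‖ ≤ ((J : ℝ)⁻¹) ^ 2 * |(k : ℝ)| ^ 2 := by
  rw [multiplier_dirichletKernel]
  split_ifs with h
  · simp only [Complex.ofReal_one, sub_self, norm_zero]
    positivity
  · rw [← mul_pow]
    simpa using one_le_pow₀ (n := 2) (one_le_inv_mul_abs hJ (not_le.1 h).le)

theorem norm_multiplier_dirichletKernel_mul_cos_sub_one_le {J : ℕ} (hJ : 1 ≤ J) (k : ℤ) :
    ‖multiplier (fun α => dirichletKernel J α * Real.cos α) k - (1 : ℝ)‖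
      ≤ (J : ℝ)⁻¹ * |(k : ℝ)| := by
  rw [multiplier_mul_cos (continuous_dirichletKernel J), multiplier_dirichletKernel,
    multiplier_dirichletKernel]
  -- The inequality must be strict: it keeps both `k + 1` and `k - 1` inside the window `[-J, J]`.
  by_cases hk : |k| < J
  · rw [if_pos (by rw [abs_lt] at hk; rw [abs_le]; omega),
      if_pos (by rw [abs_lt] at hk; rw [abs_le]; omega)]
    norm_num
    positivity
  · refine le_trans ?_ (one_le_inv_mul_abs hJ (not_lt.1 hk))
    split_ifs <;> norm_num

theorem norm_multiplier_dirichletKernel_mul_sin_le {J : ℕ} (hJ : 1 ≤ J) (k : ℤ) :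
    ‖multiplier (fun α => dirichletKernel J α * Real.sin α) k - (0 : ℝ)‖
      ≤ (J : ℝ)⁻¹ * |(k : ℝ)| := by
  rw [multiplier_mul_sin (continuous_dirichletKernel J), multiplier_dirichletKernel,
    multiplier_dirichletKernel]
  -- Inside the window the two shifted values are equal and cancel.
  by_cases hk : |k| < J
  · rw [if_pos (by rw [abs_lt] at hk; rw [abs_le]; omega),
      if_pos (by rw [abs_lt] at hk; rw [abs_le]; omega)]
    simp only [mul_one, add_neg_cancel, Complex.ofReal_zero, sub_zero, norm_zero]
    positivity
  · refine le_trans ?_ (one_le_inv_mul_abs hJ (not_lt.1 hk))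
    split_ifs <;> norm_num

section Estimates

variable {R : ℝ} {J : ℕ} {w g : Plane → ℝ}

theorem normL2_rotAvg_cos_sub_le (hJ : 1 ≤ J) (hw : MemLp w 2 (diskMeasure R))
    (hg : MemLp g 2 (diskMeasure R)) (hwg : IsAngularDeriv (Metric.ball 0 R) w g) :
    normL2 (Metric.ball 0 R) (rotAvg (fun α => dirichletKernel J α * Real.cos α) w - w)
      ≤ (J : ℝ)⁻¹ * normL2 (Metric.ball 0 R) g := by
  have := normL2_rotAvg_sub_smul_le_angularDeriv
    ((continuous_dirichletKernel J).mul Real.continuous_cos) (by positivity) hw hg hwg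
    (norm_multiplier_dirichletKernel_mul_cos_sub_one_le hJ)
  rwa [one_smul] at this

theorem normL2_rotAvg_sin_le (hJ : 1 ≤ J) (hw : MemLp w 2 (diskMeasure R))
    (hg : MemLp g 2 (diskMeasure R)) (hwg : IsAngularDeriv (Metric.ball 0 R) w g) :
    normL2 (Metric.ball 0 R) (rotAvg (fun α => dirichletKernel J α * Real.sin α) w)
      ≤ (J : ℝ)⁻¹ * normL2 (Metric.ball 0 R) g := by
  have := normL2_rotAvg_sub_smul_le_angularDeriv
    ((continuous_dirichletKernel J).mul Real.continuous_sin) (by positivity) hw hg hwg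
    (norm_multiplier_dirichletKernel_mul_sin_le hJ)
  rwa [zero_smul, sub_zero] at this

theorem normL2_rotAvg_neg_sin_le (hJ : 1 ≤ J) (hw : MemLp w 2 (diskMeasure R))
    (hg : MemLp g 2 (diskMeasure R)) (hwg : IsAngularDeriv (Metric.ball 0 R) w g) :
    normL2 (Metric.ball 0 R) (rotAvg (fun α => dirichletKernel J α * -Real.sin α) w)
      ≤ (J : ℝ)⁻¹ * normL2 (Metric.ball 0 R) g := by
  have h : rotAvg (fun α => dirichletKernel J α * -Real.sin α) w
      = -rotAvg (fun α => dirichletKernel J α * Real.sin α) w := by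
    ext x
    simp [rotAvg, integral_neg]
  rw [h, normL2_neg]
  exact normL2_rotAvg_sin_le hJ hw hg hwg

theorem normL2_rotAvg_dirichletKernel_sub_le {h : Plane → ℝ} (hJ : 1 ≤ J)
    (hw : MemLp w 2 (diskMeasure R)) (hg : MemLp g 2 (diskMeasure R))
    (hh : MemLp h 2 (diskMeasure R)) (hwg : IsAngularDeriv (Metric.ball 0 R) w g)
    (hgh : IsAngularDeriv (Metric.ball 0 R) g h) :
    normL2 (Metric.ball 0 R) (rotAvg (dirichletKernel J) w - w)
      ≤ ((J : ℝ)⁻¹) ^ 2 * normL2 (Metric.ball 0 R) h := by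
  have := normL2_rotAvg_sub_smul_le (continuous_dirichletKernel J) (ε := 1)
    (δ := ((J : ℝ)⁻¹) ^ 2) (by positivity) hw hh fun k => by
      filter_upwards [rotAvg_expKernel_angularDeriv hw hg hwg k,
        rotAvg_expKernel_angularDeriv hg hh hgh k] with x h1 h2
      rw [h2, h1, ← mul_assoc (_ * Complex.I), norm_mul (_ * _), ← sq, norm_pow, norm_mul,
        Complex.norm_I, mul_one, Complex.norm_intCast, ← mul_assoc]
      exact mul_le_mul_of_nonneg_right (norm_multiplier_dirichletKernel_sub_one_le hJ k)
        (norm_nonneg _)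
  rwa [one_smul] at this

end Estimates

/-! ### Angular derivatives of `H²` functions. -/

/-- The angular derivative `∂_θ w = x₀ ∂₁w - x₁ ∂₀w`, for `w ∈ H¹`. -/
def angularDeriv (R : ℝ) (w : Plane → ℝ) : Plane → ℝ :=
  (fun x => x 0 * weakPartial (Metric.ball 0 R) 1 w x)
    - fun x => x 1 * weakPartial (Metric.ball 0 R) 0 w x

theorem MemH1.memLp_angularDeriv {R : ℝ} {w : Plane → ℝ} (hw : MemH1 (Metric.ball 0 R) w) :
    MemLp (angularDeriv R w) 2 (diskMeasure R) :=
  (memLp_coord_mul (hw.memLp_weakPartial 1) 0).sub (memLp_coord_mul (hw.memLp_weakPartial 0) 1)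

theorem MemH1.isAngularDeriv {R : ℝ} {w : Plane → ℝ} (hw : MemH1 (Metric.ball 0 R) w) :
    IsAngularDeriv (Metric.ball 0 R) w (angularDeriv R w) :=
  isAngularDeriv_of_isWeakPartial hw.1 (hw.memLp_weakPartial 0) (hw.memLp_weakPartial 1)
    (hw.isWeakPartial 0) (hw.isWeakPartial 1)

theorem MemH1.normL2_angularDeriv_le {R : ℝ} (hR : 0 ≤ R) {w : Plane → ℝ}
    (hw : MemH1 (Metric.ball 0 R) w) :
    normL2 (Metric.ball 0 R) (angularDeriv R w)
      ≤ R * normL2 (Metric.ball 0 R) (weakPartial (Metric.ball 0 R) 1 w)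
        + R * normL2 (Metric.ball 0 R) (weakPartial (Metric.ball 0 R) 0 w) :=
  (normL2_sub_le (memLp_coord_mul (hw.memLp_weakPartial 1) 0)
    (memLp_coord_mul (hw.memLp_weakPartial 0) 1)).trans
    (add_le_add (normL2_coord_mul_le hR (hw.memLp_weakPartial 1) 0)
      (normL2_coord_mul_le hR (hw.memLp_weakPartial 0) 1))

theorem MemH2.normL2_angularDeriv_weakPartial_le {R : ℝ} (hR : 0 ≤ R) {u : Plane → ℝ}
    (hu : MemH2 (Metric.ball 0 R) u) (i : Fin 2) :
    normL2 (Metric.ball 0 R) (angularDeriv R (weakPartial (Metric.ball 0 R) i u))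
      ≤ 2 * R * normH2 (Metric.ball 0 R) u := by
  have h := (hu.memH1_weakPartial i).normL2_angularDeriv_le hR
  have h0 := mul_le_mul_of_nonneg_left
    (normL2_weakPartial_weakPartial_le_normH2 (Metric.ball 0 R) u i 0) hR
  have h1 := mul_le_mul_of_nonneg_left
    (normL2_weakPartial_weakPartial_le_normH2 (Metric.ball 0 R) u i 1) hR
  linarith

/-- The second angular derivative of an `H²` function is square integrable. -/
theorem MemH2.exists_second_angularDeriv {R : ℝ} (hR : 0 ≤ R) {u : Plane → ℝ}
    (hu : MemH2 (Metric.ball 0 R) u) :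
    ∃ h, MemLp h 2 (diskMeasure R) ∧ IsAngularDeriv (Metric.ball 0 R) (angularDeriv R u) h ∧
      normL2 (Metric.ball 0 R) h ≤ (4 * R ^ 2 + 2 * R) * normH2 (Metric.ball 0 R) u := by
  set N := normH2 (Metric.ball 0 R) u
  set p := weakPartial (Metric.ball 0 R) 0 u
  set q := weakPartial (Metric.ball 0 R) 1 u
  have hp : MemH1 (Metric.ball 0 R) p := hu.memH1_weakPartial 0
  have hq : MemH1 (Metric.ball 0 R) q := hu.memH1_weakPartial 1
  have hp2 : MemLp p 2 (diskMeasure R) := hp.1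
  have hq2 : MemLp q 2 (diskMeasure R) := hq.1
  have hdp := hp.memLp_angularDeriv
  have hdq := hq.memLp_angularDeriv
  have e0 : (fun x => perp x 0 * q x) = -fun x => x 1 * q x := by
    ext x
    simp [perp]
  have e1 : (fun x => perp x 1 * p x) = fun x => x 0 * p x := by
    ext x
    simp [perp]
  have aq := IsAngularDeriv.coord_mul hq2 hdq hq.isAngularDeriv 0
  have ap := IsAngularDeriv.coord_mul hp2 hdp hp.isAngularDeriv 1
  rw [e0] at aq
  rw [e1] at ap
  have mq1 := memLp_coord_mul hdq 0
  have mq2 := (memLp_coord_mul hq2 1).neg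
  have mp1 := memLp_coord_mul hdp 1
  have mp2 := memLp_coord_mul hp2 0
  -- The witness is `∂_θ²u = x₀∂_θq - x₁q - x₁∂_θp - x₀p`. Each term in `∂_θp` or `∂_θq` costs `R ·
  -- 2R`, and each term in `p` or `q` costs `R`, which gives `4R² + 2R`.
  refine ⟨_, (mq1.add mq2).sub (mp1.add mp2), IsAngularDeriv.sub (memLp_coord_mul hq2 0)
    (memLp_coord_mul hp2 1) (mq1.add mq2) (mp1.add mp2) aq ap, ?_⟩
  have t0 := normL2_sub_le (mq1.add mq2) (mp1.add mp2)
  have t1 := normL2_add_le mq1 mq2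
  have t2 := normL2_add_le mp1 mp2
  rw [normL2_neg] at t1
  have b1 := normL2_coord_mul_le hR hdq 0
  have b2 := normL2_coord_mul_le hR hq2 1
  have b3 := normL2_coord_mul_le hR hdp 1
  have b4 := normL2_coord_mul_le hR hp2 0
  have c1 := mul_le_mul_of_nonneg_left (hu.normL2_angularDeriv_weakPartial_le hR 1) hR
  have c2 := mul_le_mul_of_nonneg_left (normL2_weakPartial_le_normH2 (Metric.ball 0 R) u 1) hR
  have c3 := mul_le_mul_of_nonneg_left (hu.normL2_angularDeriv_weakPartial_le hR 0) hR
  have c4 := mul_le_mul_of_nonneg_left (normL2_weakPartial_le_normH2 (Metric.ball 0 R) u 0) hR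
  linarith

theorem inv_le_inv_sqrt {J : ℕ} (hJ : 1 ≤ J) : (J : ℝ)⁻¹ ≤ (√(J : ℝ))⁻¹ := by
  have hJ' : (1 : ℝ) ≤ J := by exact_mod_cast hJ
  refine inv_anti₀ (by positivity) ?_
  rw [Real.sqrt_le_left (by positivity)]
  nlinarith

/-! ### The truncation error. -/

/-- The partial derivatives of the truncation error, and their size. -/
theorem MemH2.exists_isWeakPartial_truncation_sub {R : ℝ} (hR : 0 ≤ R) {u : Plane → ℝ}
    (hu : MemH2 (Metric.ball 0 R) u) {J : ℕ} (hJ : 1 ≤ J) (i : Fin 2) :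
    ∃ g, IsWeakPartial (Metric.ball 0 R) i (truncation u J - u) g ∧ MemLp g 2 (diskMeasure R) ∧
      normL2 (Metric.ball 0 R) g ≤ (J : ℝ)⁻¹ * (4 * R * normH2 (Metric.ball 0 R) u) := by
  have hu2 : MemLp u 2 (diskMeasure R) := hu.1
  have hD := continuous_dirichletKernel J
  have hp := hu.memH1_weakPartial 0
  have hq := hu.memH1_weakPartial 1
  have hp2 : MemLp _ 2 (diskMeasure R) := hp.1
  have hq2 : MemLp _ 2 (diskMeasure R) := hq.1
  have hTD := memLp_rotAvg hD hu2
  have hae := truncation_ae_eq_rotAvg hu2 J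
  have htr : MemLp (truncation u J) 2 (diskMeasure R) := MemLp.ae_eq hae.symm hTD
  have hJ0 : (0 : ℝ) ≤ (J : ℝ)⁻¹ := by positivity
  have np := mul_le_mul_of_nonneg_left (hu.normL2_angularDeriv_weakPartial_le hR 0) hJ0
  have nq := mul_le_mul_of_nonneg_left (hu.normL2_angularDeriv_weakPartial_le hR 1) hJ0
  have hmc := hD.mul Real.continuous_cos
  have hms := hD.mul Real.continuous_sin
  have hmn := hD.mul Real.continuous_sin.neg
  fin_cases i
  · have hw := isWeakPartial_rotAvg hD Real.continuous_cos Real.continuous_sin rot_single_zero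
      hu2 hp2 hq2 (hu.memH1.isWeakPartial 0) (hu.memH1.isWeakPartial 1)
    have m1 := memLp_rotAvg hmc hp2
    have m2 := memLp_rotAvg hms hq2
    refine ⟨_, (hw.congr_ae hae.symm htr).sub htr hu2 (hu.memH1.isWeakPartial 0),
      (m1.add m2).sub hp2, ?_⟩
    -- The cosine average is close to the identity and is paired with `∂₀u`; the sine average of
    -- `∂₁u` is small by itself. Each contributes `2R`. For `i = 1` the roles are exchanged.
    rw [add_sub_right_comm]
    have t := normL2_add_le (m1.sub hp2) m2
    have b1 := normL2_rotAvg_cos_sub_le hJ hp2 hp.memLp_angularDeriv hp.isAngularDeriv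
    have b2 := normL2_rotAvg_sin_le hJ hq2 hq.memLp_angularDeriv hq.isAngularDeriv
    refine t.trans ((add_le_add b1 b2).trans ?_)
    linarith
  · have hw := isWeakPartial_rotAvg hD Real.continuous_sin.neg Real.continuous_cos rot_single_one
      hu2 hp2 hq2 (hu.memH1.isWeakPartial 0) (hu.memH1.isWeakPartial 1)
    have m1 := memLp_rotAvg hmn hp2
    have m2 := memLp_rotAvg hmc hq2
    refine ⟨_, (hw.congr_ae hae.symm htr).sub htr hu2 (hu.memH1.isWeakPartial 1),
      (m1.add m2).sub hq2, ?_⟩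
    rw [add_sub_assoc]
    have t := normL2_add_le m1 (m2.sub hq2)
    have b1 := normL2_rotAvg_neg_sin_le hJ hp2 hp.memLp_angularDeriv hp.isAngularDeriv
    have b2 := normL2_rotAvg_cos_sub_le hJ hq2 hq.memLp_angularDeriv hq.isAngularDeriv
    refine t.trans ((add_le_add b1 b2).trans ?_)
    linarith

theorem MemH2.normL2_truncation_sub_le {R : ℝ} (hR : 0 ≤ R) {u : Plane → ℝ}
    (hu : MemH2 (Metric.ball 0 R) u) {J : ℕ} (hJ : 1 ≤ J) :
    normL2 (Metric.ball 0 R) (truncation u J - u)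
      ≤ ((J : ℝ)⁻¹) ^ 2 * ((4 * R ^ 2 + 2 * R) * normH2 (Metric.ball 0 R) u) := by
  obtain ⟨h, hh, hgh, hn⟩ := hu.exists_second_angularDeriv hR
  rw [normL2_congr ((truncation_ae_eq_rotAvg hu.1 J).sub (ae_eq_refl u))]
  exact (normL2_rotAvg_dirichletKernel_sub_le hJ hu.1 hu.memH1.memLp_angularDeriv hh
    hu.memH1.isAngularDeriv hgh).trans (by gcongr)

end AngularFourier

end

theorem mainTheorem7 (R : ℝ) (hR : 0 < R) :
    ∃ C : ℝ, 0 < C ∧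
      ∀ u : AngularFourier.Plane → ℝ, AngularFourier.MemH2 (Metric.ball 0 R) u →
        ∀ J : ℕ, 1 ≤ J →
          AngularFourier.MemH1 (Metric.ball 0 R) (AngularFourier.truncation u J - u) ∧
          AngularFourier.normL2 (Metric.ball 0 R) (AngularFourier.truncation u J - u)
            ≤ C / (J * √(J : ℝ)) * AngularFourier.normH2 (Metric.ball 0 R) u ∧
          AngularFourier.normH1 (Metric.ball 0 R) (AngularFourier.truncation u J - u)
            ≤ C / √(J : ℝ) * AngularFourier.normH2 (Metric.ball 0 R) u := by
  -- The constant is `4R² + 2R` for the function itself plus `4R` for each of the two partial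
  -- derivatives.
  refine ⟨4 * R ^ 2 + 10 * R, by positivity, fun u hu J hJ => ?_⟩
  have hL := hu.normL2_truncation_sub_le hR.le hJ
  choose g hg hg2 hgn using hu.exists_isWeakPartial_truncation_sub hR.le hJ
  have hN : 0 ≤ AngularFourier.normH2 (Metric.ball 0 R) u := Real.sqrt_nonneg _
  set N := AngularFourier.normH2 (Metric.ball 0 R) u
  have hJ1 : (1 : ℝ) ≤ J := by exact_mod_cast hJ
  have hinv := AngularFourier.inv_le_inv_sqrt hJ
  have hinv1 : (J : ℝ)⁻¹ ≤ 1 := inv_le_one_of_one_le₀ hJ1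
  have hinv0 : (0 : ℝ) ≤ (J : ℝ)⁻¹ := by positivity
  have hA : 0 ≤ (4 * R ^ 2 + 2 * R) * N := by positivity
  refine ⟨⟨?_, fun i => ⟨g i, hg i, hg2 i⟩⟩, ?_, ?_⟩
  · have h := AngularFourier.memLp_rotAvg (AngularFourier.continuous_dirichletKernel J) hu.1
    exact (MeasureTheory.MemLp.ae_eq
      (AngularFourier.truncation_ae_eq_rotAvg hu.1 J).symm h).sub hu.1
  · refine hL.trans ?_
    calc ((J : ℝ)⁻¹) ^ 2 * ((4 * R ^ 2 + 2 * R) * N)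
        ≤ ((J : ℝ)⁻¹ * (√(J : ℝ))⁻¹) * ((4 * R ^ 2 + 10 * R) * N) := by
          rw [sq]
          gcongr
          linarith
      _ = (4 * R ^ 2 + 10 * R) / (J * √(J : ℝ)) * N := by
          rw [div_eq_mul_inv, mul_inv]
          ring
  · refine (AngularFourier.normH1_le _ _).trans ?_
    rw [Fin.sum_univ_two, AngularFourier.normL2_congr (hg 0).weakPartial_ae_eq,
      AngularFourier.normL2_congr (hg 1).weakPartial_ae_eq]
    -- One power of `J⁻¹` is given up so that all three terms of the `H¹` bound carry the same
    -- factor.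
    have hL' : ((J : ℝ)⁻¹) ^ 2 * ((4 * R ^ 2 + 2 * R) * N)
        ≤ (J : ℝ)⁻¹ * ((4 * R ^ 2 + 2 * R) * N) := by
      gcongr
      exact pow_le_of_le_one hinv0 hinv1 two_ne_zero
    have h0 := hgn 0
    have h1 := hgn 1
    calc _ ≤ (J : ℝ)⁻¹ * ((4 * R ^ 2 + 10 * R) * N) := by linarith
      _ ≤ (√(J : ℝ))⁻¹ * ((4 * R ^ 2 + 10 * R) * N) := by gcongr
      _ = (4 * R ^ 2 + 10 * R) / √(J : ℝ) * N := by
          rw [div_eq_mul_inv]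
          ring
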